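/- Let $C$ be a locally presentable category with a weak factorization system $(\mathcal L,\mathcal R)$ that is cofibrantly generated (i.e. $\mathcal R=r(S)$ for a small set $S$ of morphisms, where $r(-)$ and $l(-)$ denote the classes of morphisms with the right, resp. left, lifting property), and assume that $\emptyset\to X$ lies in $\mathcal L$ for every object $X$. A functorial cylinder consists of an endofunctor $I\colon C\to C$ and natural transformations $\partial_0,\partial_1\colon \mathrm{id}_C\Rightarrow I$ and $\sigma\colon I\Rightarrow \mathrm{id}_C$ with $\sigma\partial_0=\sigma\partial_1=\mathrm{id}$, such that $(\partial_0,\partial_1)\colon X\sqcup X\to IX$ is in $\mathcal L$ for every $X$. For $i\colon K\to L$ write $\partial_\varepsilon\boxtimes i\colon L\sqcup_{K}IK\to IL$ (attached along $\partial_\varepsilon\colon K\to IK$, $\varepsilon=0,1$) and $\partial I\boxtimes i\colon (L\sqcup L)\sqcup_{K\sqcup K}IK\to IL$ for the induced maps. The cylinder is exact if $I$ preserves small colimits and $\partial I\boxtimes j$, $\partial_0\boxtimes j$ and $\partial_1\boxtimes j$ are in $\mathcal L$ for all $j\in\mathcal L$. A class $An^l(I)\subseteq\mathcal L$ is a class of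 left $I$-anodyne extensions if (a) $An^l(I)=l(r(\Lambda))$ for some small set $\Lambda\subseteq\mathcal L$; (b) $\partial_0\boxtimes i\in An^l(I)$ for all $i\in\mathcal L$; (c) $\partial I\boxtimes i\in An^l(I)$ for all $i\in An^l(I)$. A left homotopical structure on $C$ is an exact cylinder together with such a class. A left $I$-fibration is a morphism in $r(An^l(I))$, and an object is left $I$-fibrant if its map to the terminal object is a left $I$-fibration. An $I$-homotopy from $f$ to $g\colon X\to Y$ is a morphism $h\colon IX\to Y$ with $h\circ\partial_0=f$ and $h\circ\partial_1=g$; $[X,Y]_I$ is the quotient of $\mathrm{Hom}_C(X,Y)$ by the equivalence relation generated by $I$-homotopy. **Theorem.** Suppose given a left homotopical structure on $C$. Then there exists a unique model structure on $C$ such that 1. the cofibrations are precisely the morphisms in $\mathcal L$; 2. a morphism $f\colon A\to B$ is a weak equivalence if and only if for every left $I$-fibrant object $W$ the induced map $f^*\colon[B,W]_I\to[A,W]_I$ is bijective. Furthermore, in this model structure an object is fibrant if and only if it is left $I$-fibrant, and a morphism between left $I$-fibrant objects is a fibration if and only if it is a left $I$-fibration. -/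

import Mathlib

open CategoryTheory Limits HomotopicalAlgebra MorphismProperty

universe w u

/-- A locally presentable category has all small colimits. -/
instance IsLocallyPresentable.hasColimits {C : Type u} [Category.{w} C]
    [IsLocallyPresentable.{w} C] : HasColimits C := by
  obtain ⟨κ, _, _⟩ := IsLocallyPresentable.exists_cardinal.{w} C
  exact IsCardinalLocallyPresentable.toHasColimitsOfSize κ

/-- A locally presentable category has a terminal object. -/
instance IsLocallyPresentable.hasTerminal {C : Type u} [Category.{w} C]
    [IsLocallyPresentable.{w} C] : HasTerminal C := by
  obtain ⟨κ, _, _⟩ := IsLocallyPresentable.exists_cardinal.{w} C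
  obtain ⟨P, _, hP⟩ := HasCardinalFilteredGenerator.exists_small_generator C κ
  have : EssentiallySmall.{w} P.FullSubcategory := essentiallySmall_of_small_of_locallySmall _
  have : HasColimitsOfShape P.FullSubcategory C := hasColimitsOfShape_of_essentiallySmall _ _
  have h (X : Cᵒᵖ) : Nonempty (Opposite.op (colimit P.ι) ⟶ X) := by
    obtain ⟨J, _, _, ⟨p⟩⟩ := hP.exists_colimitsOfShape X.unop
    exact ⟨(p.isColimit.desc
      { pt := colimit P.ι
        ι := { app := fun j => colimit.ι P.ι ⟨p.diag.obj j, p.prop_diag_obj j⟩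
               naturality := fun i j f => by
                simpa using colimit.w P.ι (j := ⟨_, p.prop_diag_obj j⟩)
                  (j' := ⟨_, p.prop_diag_obj i⟩) (ObjectProperty.homMk (p.diag.map f)) } }).op⟩
  have : HasInitial Cᵒᵖ := hasInitial_of_weakly_initial_and_hasWideEqualizers h
  exact hasTerminal_of_hasInitial_op

namespace DirectedCylinder

variable {C : Type u} [Category.{w} C]

/-- The weak factorization system `(L, R)` is cofibrantly generated: there is a small set `S` of
morphisms with `R = r(S)` (hence `L = l(r(S))`). -/
def IsCofibrantlyGeneratedWFS (L R : MorphismProperty C) : Prop :=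
  IsWeakFactorizationSystem L R ∧ ∃ S : MorphismProperty C, IsSmall.{w} S ∧ S.rlp = R

/-- For a natural transformation `α : F ⟶ G` of endofunctors and `i : K ⟶ L`, the induced map
`F L ⊔_{F K} G K ⟶ G L` out of the pushout. -/
noncomputable def box [HasPushouts C] {F G : C ⥤ C} (α : F ⟶ G) {K L : C} (i : K ⟶ L) :
    pushout (F.map i) (α.app K) ⟶ G.obj L :=
  pushout.desc (α.app L) (G.map i) (α.naturality i)

/-- The endofunctor `∂I = id ⊔ id`, `X ↦ X ⊔ X`. -/
@[simps]
noncomputable def boundary (C : Type u) [Category.{w} C] [HasBinaryCoproducts C] : C ⥤ C where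
  obj X := X ⨿ X
  map f := coprod.map f f

/-- The natural transformation `∂₀ ⊔ ∂₁ : id ⊔ id ⟶ I`. -/
@[simps]
noncomputable def boundaryMap [HasBinaryCoproducts C] {I : C ⥤ C} (d₀ d₁ : 𝟭 C ⟶ I) :
    boundary C ⟶ I where
  app X := coprod.desc (X := X) (Y := X) (W := I.obj X) (d₀.app X) (d₁.app X)
  naturality X Y f := by
    have h₀ : f ≫ d₀.app Y = d₀.app X ≫ I.map f := d₀.naturality f
    have h₁ : f ≫ d₁.app Y = d₁.app X ≫ I.map f := d₁.naturality f
    change coprod.map f f ≫ coprod.desc (X := Y) (Y := Y) (W := I.obj Y) (d₀.app Y) (d₁.app Y) =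
      coprod.desc (X := X) (Y := X) (W := I.obj X) (d₀.app X) (d₁.app X) ≫ I.map f
    rw [coprod.map_desc, coprod.desc_comp]
    exact congrArg₂ coprod.desc h₀ h₁

/-- A functorial cylinder object with respect to the left class `L`. -/
structure FunctorialCylinder [HasBinaryCoproducts C] (L : MorphismProperty C) where
  /-- the cylinder functor -/
  I : C ⥤ C
  /-- the inclusion of the end `0` -/
  d₀ : 𝟭 C ⟶ I
  /-- the inclusion of the end `1` -/
  d₁ : 𝟭 C ⟶ I
  /-- the projection -/
  σ : I ⟶ 𝟭 C
  d₀_σ : d₀ ≫ σ = 𝟙 (𝟭 C)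
  d₁_σ : d₁ ≫ σ = 𝟙 (𝟭 C)
  boundary_mem (X : C) : L ((boundaryMap d₀ d₁).app X)

/-- A functorial cylinder is exact with respect to the left class `L`. -/
structure FunctorialCylinder.IsExact [HasBinaryCoproducts C] [HasPushouts C]
    {L : MorphismProperty C} (c : FunctorialCylinder L) : Prop where
  preservesColimits : PreservesColimits c.I
  boundary_box_mem {A B : C} (j : A ⟶ B) (hj : L j) : L (box (boundaryMap c.d₀ c.d₁) j)
  d₀_box_mem {A B : C} (j : A ⟶ B) (hj : L j) : L (box c.d₀ j)
  d₁_box_mem {A B : C} (j : A ⟶ B) (hj : L j) : L (box c.d₁ j)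

/-- `An` is a class of left `I`-anodyne extensions. -/
structure FunctorialCylinder.IsLeftAnodyneClass [HasBinaryCoproducts C] [HasPushouts C]
    {L : MorphismProperty C} (c : FunctorialCylinder L) (An : MorphismProperty C) : Prop where
  le : An ≤ L
  exists_generators : ∃ Λ : MorphismProperty C, IsSmall.{w} Λ ∧ Λ ≤ L ∧ An = Λ.rlp.llp
  d₀_box_mem {A B : C} (i : A ⟶ B) (hi : L i) : An (box c.d₀ i)
  boundary_box_mem {A B : C} (i : A ⟶ B) (hi : An i) : An (box (boundaryMap c.d₀ c.d₁) i)

/-- A left homotopical structure: an exact cylinder together with a choice of a class of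
left `I`-anodyne extensions. -/
structure LeftHomotopicalStructure [HasBinaryCoproducts C] [HasPushouts C]
    (L : MorphismProperty C) extends FunctorialCylinder L where
  isExact : toFunctorialCylinder.IsExact
  /-- the class of left `I`-anodyne extensions -/
  An : MorphismProperty C
  isLeftAnodyneClass : toFunctorialCylinder.IsLeftAnodyneClass An

namespace FunctorialCylinder

variable [HasBinaryCoproducts C] {L : MorphismProperty C} (c : FunctorialCylinder L)

/-- There is an `I`-homotopy from `f` to `g`. -/
def Homotopic {X Y : C} (f g : X ⟶ Y) : Prop :=
  ∃ h : c.I.obj X ⟶ Y, c.d₀.app X ≫ h = f ∧ c.d₁.app X ≫ h = g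

/-- The set `[X, Y]_I`: the quotient of `Hom(X, Y)` by the equivalence relation generated by
`I`-homotopy (`Quot` quotients by the generated equivalence relation). -/
def HomotopyClasses (X Y : C) : Type w := Quot (c.Homotopic (X := X) (Y := Y))

/-- The map `f^* : [B, W]_I → [A, W]_I` induced by `f : A ⟶ B`. -/
def precomp {A B : C} (f : A ⟶ B) (W : C) : c.HomotopyClasses B W → c.HomotopyClasses A W :=
  Quot.map (fun g => f ≫ g) (by
    rintro g g' ⟨h, rfl, rfl⟩
    have h₀ := c.d₀.naturality f
    have h₁ := c.d₁.naturality f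
    simp only [Functor.id_obj, Functor.id_map] at h₀ h₁
    exact ⟨c.I.map f ≫ h, by rw [← Category.assoc, ← h₀, Category.assoc],
      by rw [← Category.assoc, ← h₁, Category.assoc]⟩)

end FunctorialCylinder

namespace LeftHomotopicalStructure

variable [HasBinaryCoproducts C] [HasPushouts C] {L : MorphismProperty C}
  (H : LeftHomotopicalStructure L)

/-- Left `I`-fibrations: the right lifting property against left `I`-anodyne extensions. -/
def leftFibrations : MorphismProperty C := H.An.rlp

/-- Left `I`-fibrant objects. -/
def IsLeftFibrant [HasTerminal C] (X : C) : Prop := H.leftFibrations (terminal.from X)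

/-- The model structure `M` has cofibrations `L`, and its weak equivalences are the morphisms
inducing bijections on `[-, W]_I` for all left `I`-fibrant `W`. -/
def IsDescriptionOf [HasTerminal C] (M : ModelCategory C) : Prop :=
  cofibrations C = L ∧
  ∀ {A B : C} (f : A ⟶ B), weakEquivalences C f ↔
    ∀ W : C, H.IsLeftFibrant W → Function.Bijective (H.precomp f W)

end LeftHomotopicalStructure

end DirectedCylinder

/-! ### Lifting against box products, and the calculus of cylinders. -/

namespace DirectedCylinder

variable {C : Type u} [Category.{w} C]

/-! The argument is Jeff Smith's recognition principle, with the cylinder supplying what is needed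
about the class `H.W` of proposed weak equivalences.

Left fibrations lift homotopies and fill open boxes, so `I`-homotopy is an equivalence relation on
maps into a left fibrant object, and anodyne maps and maps in `R` lie in `H.W`. The central fact is
`rlp_of_leftFibrations_of_W`: a left fibration in `H.W` with left fibrant codomain is in `R`. It
yields `llp_of_W` and `W_of_llp`: a map of `L` is in `H.W` exactly when it lifts against all left
fibrations with left fibrant codomain. Hence `L ⊓ H.W` has the closure properties of a left lifting
class, and the fibrations between left fibrant objects are identified at once.

The remaining point is that `L ⊓ H.W` is generated by a small set. Replacing an arrow by a left
fibration with left fibrant codomain is an accessible functor `T`, and `f` is in `H.W` iff `T f` is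
in `R`, which is an injectivity condition in the arrow category. Such a preimage satisfies a
solution set condition (`exists_solutionSet_isInjectiveFor`), from which `exists_isSmall_rlp_inf_le`
extracts a small `J ≤ L ⊓ H.W` with `J.rlp ⊓ H.W ≤ R`. A retract argument (`llp_rlp_eq`) then gives
`J.rlp.llp = L ⊓ H.W`. Uniqueness holds because cofibrations and weak equivalences determine the
fibrations by lifting. -/

lemma inl_box [HasPushouts C] {F G : C ⥤ C} (α : F ⟶ G) {K M : C} (i : K ⟶ M) :
    pushout.inl _ _ ≫ box α i = α.app M := pushout.inl_desc _ _ _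

lemma inl_box_assoc [HasPushouts C] {F G : C ⥤ C} (α : F ⟶ G) {K M Z : C} (i : K ⟶ M)
    (h : G.obj M ⟶ Z) : pushout.inl _ _ ≫ box α i ≫ h = α.app M ≫ h := by
  rw [← Category.assoc, inl_box]

lemma inr_box [HasPushouts C] {F G : C ⥤ C} (α : F ⟶ G) {K M : C} (i : K ⟶ M) :
    pushout.inr _ _ ≫ box α i = G.map i := pushout.inr_desc _ _ _

lemma inr_box_assoc [HasPushouts C] {F G : C ⥤ C} (α : F ⟶ G) {K M Z : C} (i : K ⟶ M)
    (h : G.obj M ⟶ Z) : pushout.inr _ _ ≫ box α i ≫ h = G.map i ≫ h := by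
  rw [← Category.assoc, inr_box]

/-- By the universal property of the pushout, a lifting problem for `box α i` is a compatible pair
`(a, h)` over `b`. Every later use of the pushout goes through this form. -/
lemma exists_lift_of_box [HasPushouts C] {F G : C ⥤ C} (α : F ⟶ G) {K M X Y : C} (i : K ⟶ M)
    (p : X ⟶ Y) [HasLiftingProperty (box α i) p] (a : F.obj M ⟶ X) (h : G.obj K ⟶ X)
    (b : G.obj M ⟶ Y) (hah : F.map i ≫ a = α.app K ≫ h) (hab : a ≫ p = α.app M ≫ b)
    (hhb : h ≫ p = G.map i ≫ b) :
    ∃ l : G.obj M ⟶ X, α.app M ≫ l = a ∧ G.map i ≫ l = h ∧ l ≫ p = b := by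
  have sq : CommSq (pushout.desc a h hah) (box α i) p b := ⟨by
    apply pushout.hom_ext
    · rw [inl_box_assoc, pushout.inl_desc_assoc, hab]
    · rw [inr_box_assoc, pushout.inr_desc_assoc, hhb]⟩
  have h₀ := pushout.inl _ _ ≫= sq.fac_left
  have h₁ := pushout.inr _ _ ≫= sq.fac_left
  rw [inl_box_assoc, pushout.inl_desc] at h₀
  rw [inr_box_assoc, pushout.inr_desc] at h₁
  exact ⟨sq.lift, h₀, h₁, sq.fac_right⟩

namespace FunctorialCylinder

section

variable [HasBinaryCoproducts C] {L : MorphismProperty C} (c : FunctorialCylinder L)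

/-- The inclusion of the end `0` of the cylinder on `X`. -/
def bot (X : C) : X ⟶ c.I.obj X := c.d₀.app X

/-- The inclusion of the end `1` of the cylinder on `X`. -/
def top (X : C) : X ⟶ c.I.obj X := c.d₁.app X

/-- The projection of the cylinder on `X`. -/
def proj (X : C) : c.I.obj X ⟶ X := c.σ.app X

/-- The inclusion of both ends of the cylinder on `X`. -/
noncomputable def ends (X : C) : X ⨿ X ⟶ c.I.obj X := (boundaryMap c.d₀ c.d₁).app X

lemma bot_naturality {X Y : C} (f : X ⟶ Y) : c.bot X ≫ c.I.map f = f ≫ c.bot Y :=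
  (c.d₀.naturality f).symm

lemma bot_naturality_assoc {X Y Z : C} (f : X ⟶ Y) (h : c.I.obj Y ⟶ Z) :
    c.bot X ≫ c.I.map f ≫ h = f ≫ c.bot Y ≫ h := by
  rw [← Category.assoc, bot_naturality, Category.assoc]

lemma top_naturality {X Y : C} (f : X ⟶ Y) : c.top X ≫ c.I.map f = f ≫ c.top Y :=
  (c.d₁.naturality f).symm

lemma top_naturality_assoc {X Y Z : C} (f : X ⟶ Y) (h : c.I.obj Y ⟶ Z) :
    c.top X ≫ c.I.map f ≫ h = f ≫ c.top Y ≫ h := by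
  rw [← Category.assoc, top_naturality, Category.assoc]

lemma proj_naturality {X Y : C} (f : X ⟶ Y) : c.I.map f ≫ c.proj Y = c.proj X ≫ f :=
  c.σ.naturality f

lemma proj_naturality_assoc {X Y Z : C} (f : X ⟶ Y) (h : Y ⟶ Z) :
    c.I.map f ≫ c.proj Y ≫ h = c.proj X ≫ f ≫ h := by
  rw [← Category.assoc, proj_naturality, Category.assoc]

@[simp]
lemma bot_proj (X : C) : c.bot X ≫ c.proj X = 𝟙 X :=
  NatTrans.congr_app c.d₀_σ X

@[simp]
lemma bot_proj_assoc {X Z : C} (h : X ⟶ Z) : c.bot X ≫ c.proj X ≫ h = h := by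
  rw [← Category.assoc, bot_proj, Category.id_comp]

@[simp]
lemma top_proj (X : C) : c.top X ≫ c.proj X = 𝟙 X :=
  NatTrans.congr_app c.d₁_σ X

@[simp]
lemma top_proj_assoc {X Z : C} (h : X ⟶ Z) : c.top X ≫ c.proj X ≫ h = h := by
  rw [← Category.assoc, top_proj, Category.id_comp]

@[simp]
lemma inl_ends (X : C) : coprod.inl ≫ c.ends X = c.bot X := by
  exact coprod.inl_desc _ _

@[simp]
lemma inl_ends_assoc {X Z : C} (h : c.I.obj X ⟶ Z) :
    coprod.inl ≫ c.ends X ≫ h = c.bot X ≫ h := by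
  rw [← Category.assoc, inl_ends]

@[simp]
lemma inr_ends (X : C) : coprod.inr ≫ c.ends X = c.top X := by
  exact coprod.inr_desc _ _

@[simp]
lemma inr_ends_assoc {X Z : C} (h : c.I.obj X ⟶ Z) :
    coprod.inr ≫ c.ends X ≫ h = c.top X ≫ h := by
  rw [← Category.assoc, inr_ends]

lemma ends_mem (X : C) : L (c.ends X) := c.boundary_mem X

variable {c} in
lemma Homotopic.mk {X Y : C} {f g : X ⟶ Y} (h : c.I.obj X ⟶ Y) (h₀ : c.bot X ≫ h = f)
    (h₁ : c.top X ≫ h = g) : c.Homotopic f g := ⟨h, h₀, h₁⟩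

variable {c} in
lemma Homotopic.exists_hom {X Y : C} {f g : X ⟶ Y} (h : c.Homotopic f g) :
    ∃ h : c.I.obj X ⟶ Y, c.bot X ≫ h = f ∧ c.top X ≫ h = g := h

lemma Homotopic.refl {X Y : C} (f : X ⟶ Y) : c.Homotopic f f :=
  .mk (c.proj X ≫ f) (by simp) (by simp)

variable {c} in
lemma Homotopic.precomp {A X Y : C} {f g : X ⟶ Y} (h : c.Homotopic f g) (a : A ⟶ X) :
    c.Homotopic (a ≫ f) (a ≫ g) := by
  obtain ⟨k, rfl, rfl⟩ := h.exists_hom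
  exact .mk (c.I.map a ≫ k) (by rw [bot_naturality_assoc]) (by rw [top_naturality_assoc])

variable {c} in
lemma Homotopic.postcomp {X Y Z : C} {f g : X ⟶ Y} (h : c.Homotopic f g) (b : Y ⟶ Z) :
    c.Homotopic (f ≫ b) (g ≫ b) := by
  obtain ⟨k, rfl, rfl⟩ := h.exists_hom
  exact .mk (k ≫ b) (by simp) (by simp)

lemma precomp_id (X W : C) : c.precomp (𝟙 X) W = id := by
  ext ⟨g⟩
  exact congrArg (Quot.mk _) (Category.id_comp g)

lemma precomp_comp {X Y Z : C} (f : X ⟶ Y) (g : Y ⟶ Z) (W : C) :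
    c.precomp (f ≫ g) W = c.precomp f W ∘ c.precomp g W := by
  ext ⟨h⟩
  exact congrArg (Quot.mk _) (Category.assoc f g h)

lemma precomp_eq_of_homotopic {X Y : C} {f g : X ⟶ Y} (h : c.Homotopic f g) (W : C) :
    c.precomp f W = c.precomp g W := by
  ext ⟨k⟩
  exact Quot.sound (h.postcomp k)

end

section

variable [HasBinaryCoproducts C] [HasPushouts C] {L : MorphismProperty C}
  (c : FunctorialCylinder L)

lemma exists_lift_of_bot_box {K M X Y : C} (i : K ⟶ M) (p : X ⟶ Y)
    [HasLiftingProperty (box c.d₀ i) p] (a : M ⟶ X) (h : c.I.obj K ⟶ X) (b : c.I.obj M ⟶ Y)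
    (hah : i ≫ a = c.bot K ≫ h) (hab : a ≫ p = c.bot M ≫ b) (hhb : h ≫ p = c.I.map i ≫ b) :
    ∃ l : c.I.obj M ⟶ X, c.bot M ≫ l = a ∧ c.I.map i ≫ l = h ∧ l ≫ p = b :=
  exists_lift_of_box c.d₀ i p a h b hah hab hhb

lemma exists_lift_of_ends_box {K M X Y : C} (i : K ⟶ M) (p : X ⟶ Y)
    [HasLiftingProperty (box (boundaryMap c.d₀ c.d₁) i) p] (a₀ a₁ : M ⟶ X)
    (h : c.I.obj K ⟶ X) (b : c.I.obj M ⟶ Y)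
    (h₀ : i ≫ a₀ = c.bot K ≫ h) (h₁ : i ≫ a₁ = c.top K ≫ h)
    (h₀' : a₀ ≫ p = c.bot M ≫ b) (h₁' : a₁ ≫ p = c.top M ≫ b) (hb : h ≫ p = c.I.map i ≫ b) :
    ∃ l : c.I.obj M ⟶ X, c.bot M ≫ l = a₀ ∧ c.top M ≫ l = a₁ ∧ c.I.map i ≫ l = h ∧ l ≫ p = b := by
  have e : (boundary C).map i ≫ coprod.desc a₀ a₁ = (boundaryMap c.d₀ c.d₁).app K ≫ h := by
    change coprod.map i i ≫ coprod.desc a₀ a₁ = c.ends K ≫ h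
    ext
    · rw [coprod.inl_map_assoc, coprod.inl_desc, inl_ends_assoc, h₀]
    · rw [coprod.inr_map_assoc, coprod.inr_desc, inr_ends_assoc, h₁]
  have e' : coprod.desc a₀ a₁ ≫ p = c.ends M ≫ b := by
    ext
    · rw [coprod.inl_desc_assoc, inl_ends_assoc, h₀']
    · rw [coprod.inr_desc_assoc, inr_ends_assoc, h₁']
  obtain ⟨l, e₀, e₁, e₂⟩ := exists_lift_of_box (boundaryMap c.d₀ c.d₁) i p (coprod.desc a₀ a₁) h b
    e e' hb
  replace e₀ : c.ends M ≫ l = coprod.desc a₀ a₁ := e₀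
  refine ⟨l, ?_, ?_, e₁, e₂⟩
  · rw [← c.inl_ends, Category.assoc, e₀, coprod.inl_desc]
  · rw [← c.inr_ends, Category.assoc, e₀, coprod.inr_desc]

end

end FunctorialCylinder

/-! ### Left fibrations, homotopy into left fibrant objects, and the class `H.W`. -/

namespace LeftHomotopicalStructure

variable [HasBinaryCoproducts C] [HasPushouts C] {L : MorphismProperty C}
  (H : LeftHomotopicalStructure L)

lemma exists_lift_of_leftFibrations {K M X Y : C} {i : K ⟶ M} (hi : L i) {p : X ⟶ Y}
    (hp : H.leftFibrations p) (a : M ⟶ X) (h : H.I.obj K ⟶ X) (b : H.I.obj M ⟶ Y)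
    (hah : i ≫ a = H.bot K ≫ h) (hab : a ≫ p = H.bot M ≫ b) (hhb : h ≫ p = H.I.map i ≫ b) :
    ∃ l : H.I.obj M ⟶ X, H.bot M ≫ l = a ∧ H.I.map i ≫ l = h ∧ l ≫ p = b :=
  have := hp _ (H.isLeftAnodyneClass.d₀_box_mem i hi)
  H.exists_lift_of_bot_box i p a h b hah hab hhb

/-- Homotopies lift along left fibrations once the source has been lifted. -/
lemma exists_homotopy_lift [HasInitial C] {X Y Z : C} (hZ : L (initial.to Z)) {p : X ⟶ Y}
    (hp : H.leftFibrations p) (a : Z ⟶ X) (b : H.I.obj Z ⟶ Y) (hab : a ≫ p = H.bot Z ≫ b) :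
    ∃ l : H.I.obj Z ⟶ X, H.bot Z ≫ l = a ∧ l ≫ p = b := by
  have := H.isExact.preservesColimits
  -- `I` preserves the initial object, so the part of the homotopy prescribed on `I ∅` is no
  -- condition.
  have hI : IsInitial (H.I.obj (⊥_ C)) := initialIsInitial.isInitialObj H.I
  obtain ⟨l, h₁, -, h₂⟩ := H.exists_lift_of_leftFibrations hZ hp a (hI.to _) b
    (initialIsInitial.hom_ext _ _) hab (hI.hom_ext _ _)
  exact ⟨l, h₁, h₂⟩

/-- Left fibrations admit fillers for two-dimensional open boxes. -/
lemma exists_openBox_lift {X Y Z : C} {p : X ⟶ Y} (hp : H.leftFibrations p)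
    (k h₀ h₁ : H.I.obj Z ⟶ X) (b : H.I.obj (H.I.obj Z) ⟶ Y)
    (e₀ : H.bot Z ≫ h₀ = H.bot Z ≫ k) (e₁ : H.bot Z ≫ h₁ = H.top Z ≫ k)
    (ek : k ≫ p = H.bot _ ≫ b) (eh₀ : h₀ ≫ p = H.I.map (H.bot Z) ≫ b)
    (eh₁ : h₁ ≫ p = H.I.map (H.top Z) ≫ b) :
    ∃ l : H.I.obj (H.I.obj Z) ⟶ X, H.bot _ ≫ l = k ∧ H.I.map (H.bot Z) ≫ l = h₀ ∧
      H.I.map (H.top Z) ≫ l = h₁ ∧ l ≫ p = b := by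
  have := H.isExact.preservesColimits
  -- `I (Z ⨿ Z)` is `I Z ⨿ I Z`, so the two side faces together form a single homotopy on `Z ⨿ Z`.
  -- The box is then filled by lifting against `∂₀ ⊠ (∂₀, ∂₁)`.
  have hc := isColimitOfHasBinaryCoproductOfPreservesColimit H.I Z Z
  obtain ⟨v, hv₀, hv₁⟩ : ∃ v : H.I.obj (Z ⨿ Z) ⟶ X,
      H.I.map coprod.inl ≫ v = h₀ ∧ H.I.map coprod.inr ≫ v = h₁ :=
    ⟨_, (BinaryCofan.IsColimit.desc' hc h₀ h₁).2⟩
  obtain ⟨l, hl₁, hl₂, hl₃⟩ := H.exists_lift_of_leftFibrations (H.ends_mem Z) hp k v b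
    (by
      ext
      · rw [H.inl_ends_assoc, ← H.bot_naturality_assoc, hv₀, e₀]
      · rw [H.inr_ends_assoc, ← H.bot_naturality_assoc, hv₁, e₁]) ek
    (BinaryCofan.IsColimit.hom_ext hc
      (by
        change H.I.map coprod.inl ≫ _ = H.I.map coprod.inl ≫ _
        rw [reassoc_of% hv₀, ← Functor.map_comp_assoc, H.inl_ends, eh₀])
      (by
        change H.I.map coprod.inr ≫ _ = H.I.map coprod.inr ≫ _
        rw [reassoc_of% hv₁, ← Functor.map_comp_assoc, H.inr_ends, eh₁]))
  refine ⟨l, hl₁, ?_, ?_, hl₃⟩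
  · rw [← hv₀, ← hl₂, ← Functor.map_comp_assoc, H.inl_ends]
  · rw [← hv₁, ← hl₂, ← Functor.map_comp_assoc, H.inr_ends]

variable [HasTerminal C]

variable {H} in
lemma IsLeftFibrant.of_leftFibrations {X Y : C} (hY : H.IsLeftFibrant Y) {p : X ⟶ Y}
    (hp : H.leftFibrations p) : H.IsLeftFibrant X := by
  have : terminal.from X = p ≫ terminal.from Y := Subsingleton.elim _ _
  rw [IsLeftFibrant, this]
  exact H.An.rlp.comp_mem _ _ hp hY

lemma isLeftFibrant_terminal : H.IsLeftFibrant (⊤_ C) := by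
  have : terminal.from (⊤_ C) = 𝟙 _ := Subsingleton.elim _ _
  rw [IsLeftFibrant, this]
  exact H.An.rlp.id_mem _

variable {H}

namespace IsLeftFibrant

variable {Z : C} (hZ : H.IsLeftFibrant Z)

include hZ

/-- The fourth side of an open box filled in `Z`. Taking constant homotopies for suitable sides
gives both symmetry and transitivity. -/
lemma homotopic_of_square {X : C} {a₀ a₁ b₀ b₁ : X ⟶ Z} (k : H.Homotopic a₀ a₁)
    (h₀ : H.Homotopic a₀ b₀) (h₁ : H.Homotopic a₁ b₁) : H.Homotopic b₀ b₁ := by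
  obtain ⟨k, hk, hk'⟩ := k.exists_hom
  obtain ⟨m₀, hh₀, rfl⟩ := h₀.exists_hom
  obtain ⟨m₁, hh₁, rfl⟩ := h₁.exists_hom
  obtain ⟨l, -, hl₀, hl₁, -⟩ := H.exists_openBox_lift hZ k m₀ m₁ (terminal.from _)
    (by rw [hh₀, hk]) (by rw [hh₁, hk']) (Subsingleton.elim _ _)
    (Subsingleton.elim _ _) (Subsingleton.elim _ _)
  exact .mk (H.top _ ≫ l) (by rw [← H.top_naturality_assoc, hl₀])
    (by rw [← H.top_naturality_assoc, hl₁])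

lemma homotopic_symm {X : C} {f g : X ⟶ Z} (h : H.Homotopic f g) : H.Homotopic g f :=
  hZ.homotopic_of_square (.refl _ f) h (.refl _ f)

lemma homotopic_trans {X : C} {f g k : X ⟶ Z} (h : H.Homotopic f g) (h' : H.Homotopic g k) :
    H.Homotopic f k :=
  hZ.homotopic_of_square (.refl _ g) (hZ.homotopic_symm h) h'

lemma homotopic_of_mk_eq {X : C} {f g : X ⟶ Z}
    (h : (Quot.mk _ f : H.HomotopyClasses X Z) = Quot.mk _ g) : H.Homotopic f g := by
  have : Equivalence (H.Homotopic (X := X) (Y := Z)) :=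
    ⟨.refl _, hZ.homotopic_symm, hZ.homotopic_trans⟩
  exact this.quot_mk_eq_iff _ _ |>.1 h

end IsLeftFibrant

variable (H)

/-- The morphisms inducing bijections on homotopy classes of maps to left fibrant objects. -/
def W : MorphismProperty C := fun _ _ f =>
  ∀ Z : C, H.IsLeftFibrant Z → Function.Bijective (H.precomp f Z)

instance : H.W.HasTwoOutOfThreeProperty where
  comp_mem f g hf hg Z hZ := by
    rw [H.precomp_comp]
    exact (hf Z hZ).comp (hg Z hZ)
  of_postcomp f g hg hfg Z hZ := by
    have := hfg Z hZ
    rw [H.precomp_comp] at this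
    exact (Function.Bijective.of_comp_iff _ (hg Z hZ)).1 this
  of_precomp f g hf hfg Z hZ := by
    have := hfg Z hZ
    rw [H.precomp_comp] at this
    exact (Function.Bijective.of_comp_iff' (hf Z hZ) _).1 this

/-- `g^*` is injective because `(f ≫ g)^*` is, and surjective because `(g ≫ h)^*` is; two out of
three then handles `f`. -/
lemma W_of_two_out_of_six {X Y Z T : C} (f : X ⟶ Y) (g : Y ⟶ Z) (h : Z ⟶ T)
    (hfg : H.W (f ≫ g)) (hgh : H.W (g ≫ h)) : H.W f := by
  have hg : H.W g := fun V hV => ⟨?_, ?_⟩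
  · exact H.W.of_postcomp f g hg hfg
  · have := (hfg V hV).1
    rw [H.precomp_comp] at this
    exact this.of_comp
  · have := (hgh V hV).2
    rw [H.precomp_comp] at this
    exact this.of_comp

/-- Surjectivity is extension along `f` into a left fibrant object. Injectivity is extension along
`∂I ⊠ f`, again anodyne, of a homotopy given on `A` with both ends given on `B`. -/
lemma An_le_W : H.An ≤ H.W := by
  intro A B f hf Z hZ
  have := hZ f hf
  constructor
  · rintro ⟨g₀⟩ ⟨g₁⟩ hg
    obtain ⟨h, h₀, h₁⟩ := (hZ.homotopic_of_mk_eq hg).exists_hom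
    have := hZ _ (H.isLeftAnodyneClass.boundary_box_mem f hf)
    obtain ⟨l, hl₀, hl₁, -⟩ := H.exists_lift_of_ends_box f (terminal.from Z) g₀ g₁ h
      (terminal.from _) h₀.symm h₁.symm (Subsingleton.elim _ _) (Subsingleton.elim _ _)
      (Subsingleton.elim _ _)
    exact Quot.sound (.mk l hl₀ hl₁)
  · rintro ⟨g⟩
    have sq : CommSq g f (terminal.from Z) (terminal.from B) := ⟨Subsingleton.elim _ _⟩
    exact ⟨Quot.mk _ sq.lift, congrArg (Quot.mk _) sq.fac_left⟩

lemma W_of_homotopy_inverse {X Y : C} {f : X ⟶ Y} {g : Y ⟶ X} (h : H.Homotopic (f ≫ g) (𝟙 X))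
    (h' : H.Homotopic (g ≫ f) (𝟙 Y)) : H.W f := by
  intro Z hZ
  refine Function.bijective_iff_has_inverse.2 ⟨H.precomp g Z, fun x => ?_, fun x => ?_⟩
  · rw [← Function.comp_apply (f := H.precomp g Z), ← H.precomp_comp,
      H.precomp_eq_of_homotopic h', H.precomp_id, id]
  · rw [← Function.comp_apply (f := H.precomp f Z), ← H.precomp_comp,
      H.precomp_eq_of_homotopic h, H.precomp_id, id]

variable [HasInitial C] (hL : ∀ X : C, L (initial.to X))

include hL

/-- Since `∅ → Y` is in `L`, `p` has a section. Lifting the constant homotopy of `p` against the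
inclusion of the ends shows that the section is a homotopy inverse. -/
lemma rlp_le_W : L.rlp ≤ H.W := by
  intro X Y p hp
  have := hp _ (hL Y)
  have sq : CommSq (initial.to X) (initial.to Y) p (𝟙 Y) := ⟨Subsingleton.elim _ _⟩
  have hs : sq.lift ≫ p = 𝟙 Y := sq.fac_right
  have := hp _ (H.ends_mem X)
  have sq' : CommSq (coprod.desc (p ≫ sq.lift) (𝟙 X)) (H.ends X) p (H.proj X ≫ p) := ⟨by
    ext <;> simp [coprod.inl_desc, coprod.inr_desc, hs]⟩
  refine H.W_of_homotopy_inverse (g := sq.lift) (.mk sq'.lift ?_ ?_) (by rw [hs]; exact .refl _ _)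
  · rw [← H.inl_ends, Category.assoc, sq'.fac_left, coprod.inl_desc]
  · rw [← H.inr_ends, Category.assoc, sq'.fac_left, coprod.inr_desc]

/-- A left fibration in `W` with left fibrant codomain is a trivial fibration. -/
lemma rlp_of_leftFibrations_of_W {X Y : C} {p : X ⟶ Y} (hY : H.IsLeftFibrant Y)
    (hp : H.leftFibrations p) (hpW : H.W p) : L.rlp p := by
  have hX := hY.of_leftFibrations hp
  -- a strict section which is a homotopy inverse
  obtain ⟨s, hs, hs'⟩ : ∃ s : Y ⟶ X, s ≫ p = 𝟙 Y ∧ H.Homotopic (p ≫ s) (𝟙 X) := by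
    -- `p^*` is bijective on classes of maps into `X` and into `Y`: the first gives a left homotopy
    -- inverse `s`, the second makes `s` a homotopy section.
    obtain ⟨⟨s⟩, hs⟩ := (hpW X hX).2 (Quot.mk _ (𝟙 X))
    have h₁ : H.Homotopic (p ≫ s) (𝟙 X) := hX.homotopic_of_mk_eq hs
    have h₂ : H.Homotopic (s ≫ p) (𝟙 Y) := by
      refine hY.homotopic_of_mk_eq ((hpW Y hY).1 (Quot.sound ?_))
      simpa using h₁.postcomp p
    obtain ⟨k, hk₀, hk₁⟩ := h₂.exists_hom
    -- Lifting the homotopy `s ≫ p ~ 𝟙` from `s` makes its far end a strict section, homotopic to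
    -- `s`.
    obtain ⟨k', hk'₀, hk'⟩ := H.exists_homotopy_lift (hL Y) hp s k hk₀.symm
    refine ⟨H.top Y ≫ k', by rw [Category.assoc, hk', hk₁], ?_⟩
    exact hX.homotopic_trans
      (hX.homotopic_symm (FunctorialCylinder.Homotopic.precomp (.mk k' hk'₀ rfl) p)) h₁
  -- a fibrewise homotopy
  obtain ⟨h, h₀, h₁, hh⟩ : ∃ h : H.I.obj X ⟶ X, H.bot X ≫ h = p ≫ s ∧ H.top X ≫ h = 𝟙 X ∧
      h ≫ p = H.proj X ≫ p := by
    obtain ⟨h, h₀, h₁⟩ := hs'.exists_hom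
    -- The side faces `h ≫ p ≫ s` and `h` have the same image `h ≫ p` in `Y`. So the box lies over a
    -- degenerate square, and its missing face, from `p ≫ s` to `𝟙`, is constant over `Y`.
    obtain ⟨l, hl, hl₀, hl₁, hlp⟩ := H.exists_openBox_lift hp (H.proj X ≫ p ≫ s)
      (h ≫ p ≫ s) h (H.I.map (H.proj X) ≫ h ≫ p)
      (by rw [reassoc_of% h₀, reassoc_of% hs, H.bot_proj_assoc])
      (by rw [h₀, H.top_proj_assoc])
      (by simp only [Category.assoc, hs, Category.comp_id]
          rw [H.bot_naturality_assoc, reassoc_of% h₀, hs, Category.comp_id])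
      (by rw [← Functor.map_comp_assoc, H.bot_proj]; simp [hs])
      (by rw [← Functor.map_comp_assoc, H.top_proj]; simp)
    refine ⟨H.top _ ≫ l, ?_, ?_, ?_⟩
    · rw [← H.top_naturality_assoc, hl₀, reassoc_of% h₁]
    · rw [← H.top_naturality_assoc, hl₁, h₁]
    · rw [Category.assoc, hlp, H.top_naturality_assoc, reassoc_of% h₁]
  intro K M i hi
  refine ⟨fun {a b} sq => ?_⟩
  -- `b ≫ s` solves the problem only up to the fibrewise homotopy `h` on `K`. Extending that
  -- homotopy over `M`, above the constant one, corrects the upper triangle at the far end.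
  obtain ⟨l, -, hl, hlp⟩ := H.exists_lift_of_leftFibrations hi hp (b ≫ s) (H.I.map a ≫ h)
    (H.proj M ≫ b) (by rw [H.bot_naturality_assoc, h₀, ← sq.w_assoc])
    (by simp [hs]) (by rw [Category.assoc, hh, H.proj_naturality_assoc,
      H.proj_naturality_assoc, sq.w])
  exact ⟨⟨{
    l := H.top M ≫ l
    fac_left := by rw [← H.top_naturality_assoc, hl, H.top_naturality_assoc, h₁,
      Category.comp_id]
    fac_right := by rw [Category.assoc, hlp, H.top_proj_assoc] }⟩⟩

omit hL [HasInitial C] in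
/-- The left fibrations between left fibrant objects. -/
def leftFibrantFibrations : MorphismProperty C := fun _ Y p =>
  H.leftFibrations p ∧ H.IsLeftFibrant Y

variable [HasFactorization H.An H.leftFibrations]

-- Replace `B` by a left fibrant object and factor the composite from `A`. The lift of `i` against
-- the resulting left fibration places `i` first in a chain of three maps whose two consecutive
-- composites are anodyne, and two out of six applies.
omit hL [HasInitial C] in
lemma W_of_llp {A B : C} {i : A ⟶ B} (hi : H.leftFibrantFibrations.llp i) : H.W i := by
  let h := factorizationData H.An H.leftFibrations (terminal.from B)
  let h' := factorizationData H.An H.leftFibrations (i ≫ h.i)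
  have hB : H.IsLeftFibrant h.Z := H.isLeftFibrant_terminal.of_leftFibrations h.hp
  have := hi h'.p ⟨h'.hp, hB⟩
  have sq : CommSq h'.i i h'.p h.i := ⟨h'.fac⟩
  refine H.W_of_two_out_of_six i sq.lift h'.p ?_ ?_
  · rw [sq.fac_left]
    exact H.An_le_W _ h'.hi
  · rw [sq.fac_right]
    exact H.An_le_W _ h.hi

/-- Factor `b` through a left fibrant `Z`, pull `p` back to `Z`, and factor the induced map from `A`
as an anodyne map followed by a left fibration. The resulting left fibration over `Z` is in `H.W` by
two out of three, hence lifts against `i`. -/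
lemma llp_of_W [HasPullbacks C] {A B : C} {i : A ⟶ B} (hi : L i) (hiW : H.W i) :
    H.leftFibrantFibrations.llp i := by
  rintro X Y p ⟨hp, hY⟩
  refine ⟨fun {a b} sq => ?_⟩
  let h := factorizationData H.An H.leftFibrations b
  have hZ : H.IsLeftFibrant h.Z := hY.of_leftFibrations h.hp
  let h' := factorizationData H.An H.leftFibrations
    (pullback.lift (f := p) (g := h.p) a (i ≫ h.i) (by simpa using sq.w))
  have hq : H.leftFibrations (h'.p ≫ pullback.snd p h.p) :=
    H.An.rlp.comp_mem _ _ h'.hp (H.An.rlp.pullback_snd _ _ hp)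
  have hqW : H.W (h'.p ≫ pullback.snd p h.p) := by
    refine H.W.of_precomp h'.i _ (H.An_le_W _ h'.hi) ?_
    rw [← Category.assoc, h'.fac, pullback.lift_snd]
    exact H.W.comp_mem _ _ hiW (H.An_le_W _ h.hi)
  have := H.rlp_of_leftFibrations_of_W hL hZ hq hqW i hi
  have sq' : CommSq h'.i i (h'.p ≫ pullback.snd p h.p) h.i := ⟨by simp [pullback.lift_snd]⟩
  exact ⟨⟨{
    l := sq'.lift ≫ h'.p ≫ pullback.fst _ _
    fac_left := by simp [pullback.lift_fst]
    fac_right := by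
      have := sq'.fac_right
      simp only [Category.assoc] at this ⊢
      rw [pullback.condition, reassoc_of% this, h.fac] }⟩⟩

end LeftHomotopicalStructure

end DirectedCylinder

/-! ### Limits in locally presentable categories. -/

section

variable {C : Type u} [Category.{w} C]

/-- A locally presentable category has all small limits. -/
instance IsLocallyPresentable.hasLimits [IsLocallyPresentable.{w} C] : HasLimits C := by
  obtain ⟨κ, _, _⟩ := IsLocallyPresentable.exists_cardinal.{w} C
  -- The `κ`-presentable objects form an essentially small dense subcategory, so the restricted
  -- Yoneda functor embeds `C` reflectively in presheaves; its left adjoint is a Kan extension.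
  let F := (equivSmallModel.{w} (isCardinalPresentable C κ).FullSubcategory).inverse ⋙
    (isCardinalPresentable C κ).ι
  have : (Presheaf.restrictedULiftYoneda.{w} F).IsRightAdjoint :=
    (Presheaf.uliftYonedaAdjunction.{w} (uliftYoneda.{w}.leftKanExtension F)
      (uliftYoneda.{w}.leftKanExtensionUnit F)).isRightAdjoint
  have : Reflective (Presheaf.restrictedULiftYoneda.{w} F) := ⟨_, .ofIsRightAdjoint _⟩
  exact hasLimits_of_reflective (Presheaf.restrictedULiftYoneda.{w} F)

end

/-! ### Presentability of the arrow category. -/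

namespace CategoryTheory.Arrow

variable {C : Type u} [Category.{w} C]

section

variable {J : Type*} [Category* J] {F : J ⥤ Arrow C} {c : Cocone F}

/-- Colimits of arrows are detected on sources and targets. -/
def isColimitOfLeftRight (h₁ : IsColimit (Arrow.leftFunc.mapCocone c))
    (h₂ : IsColimit (Arrow.rightFunc.mapCocone c)) : IsColimit c :=
  Comma.fstSndJointlyReflectColimit h₁ h₂

end

variable (κ : Cardinal.{w}) [Fact κ.IsRegular]

lemma isCardinalAccessible_of_left_right {D : Type*} [Category* D] (Φ : D ⥤ Arrow C)
    [(Φ ⋙ Arrow.leftFunc).IsCardinalAccessible κ] [(Φ ⋙ Arrow.rightFunc).IsCardinalAccessible κ] :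
    Φ.IsCardinalAccessible κ where
  preservesColimitOfShape J _ _ :=
    have := (Φ ⋙ Arrow.leftFunc).preservesColimitsOfShape_of_isCardinalAccessible κ J
    have := (Φ ⋙ Arrow.rightFunc).preservesColimitsOfShape_of_isCardinalAccessible κ J
    ⟨⟨fun hc => ⟨isColimitOfLeftRight (isColimitOfPreserves (Φ ⋙ Arrow.leftFunc) hc)
      (isColimitOfPreserves (Φ ⋙ Arrow.rightFunc) hc)⟩⟩⟩

variable [HasColimits C]

/-- A map out of `f` is a pair of maps subject to one equation between maps out of `A`. The pair
descends to a stage because `A` and `B` are presentable, and the equation holds at a later one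
because `A` is. -/
instance isCardinalPresentable_mk {A B : C} (f : A ⟶ B) [IsCardinalPresentable A κ]
    [IsCardinalPresentable B κ] : IsCardinalPresentable (Arrow.mk f) κ where
  preservesColimitOfShape J _ _ := ⟨fun {F} => ⟨fun {c} hc => ⟨by
    have := isFiltered_of_isCardinalFiltered J κ
    have h₁ := isColimitOfPreserves Arrow.leftFunc hc
    have h₂ := isColimitOfPreserves Arrow.rightFunc hc
    have hsurj (x : Arrow.mk f ⟶ c.pt) :
        ∃ (j : J) (y : Arrow.mk f ⟶ F.obj j), y ≫ c.ι.app j = x := by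
      obtain ⟨j₁, a, ha⟩ : ∃ (j : J) (a : A ⟶ (F.obj j).left), a ≫ (c.ι.app j).left = x.left :=
        IsCardinalPresentable.exists_hom_of_isColimit (X := A) κ h₁ x.left
      obtain ⟨j₂, b, hb⟩ : ∃ (j : J) (b : B ⟶ (F.obj j).right),
          b ≫ (c.ι.app j).right = x.right :=
        IsCardinalPresentable.exists_hom_of_isColimit (X := B) κ h₂ x.right
      obtain ⟨k, v₁, v₂, e⟩ := IsCardinalPresentable.exists_eq_of_isColimit (X := A) κ h₂
        (a ≫ (F.obj j₁).hom) (f ≫ b) (by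
          change (a ≫ (F.obj j₁).hom) ≫ (c.ι.app j₁).right = (f ≫ b) ≫ (c.ι.app j₂).right
          rw [Category.assoc, Category.assoc, hb, ← Arrow.w (c.ι.app j₁), reassoc_of% ha]
          exact Arrow.w x)
      replace e : (a ≫ (F.obj j₁).hom) ≫ (F.map v₁).right = (f ≫ b) ≫ (F.map v₂).right := e
      have w₁ : (F.map v₁).left ≫ (c.ι.app k).left = (c.ι.app j₁).left :=
        congrArg CommaMorphism.left (c.w v₁)
      have w₂ : (F.map v₂).right ≫ (c.ι.app k).right = (c.ι.app j₂).right :=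
        congrArg CommaMorphism.right (c.w v₂)
      refine ⟨k, Arrow.homMk (a ≫ (F.map v₁).left) (b ≫ (F.map v₂).right) ?_, ?_⟩
      · change (a ≫ (F.map v₁).left) ≫ (F.obj k).hom = f ≫ b ≫ (F.map v₂).right
        rw [Category.assoc, Arrow.w (F.map v₁), ← Category.assoc, e, Category.assoc]
      · apply Arrow.hom_ext
        · change (a ≫ (F.map v₁).left) ≫ (c.ι.app k).left = x.left
          rw [Category.assoc, w₁, ha]
        · change (b ≫ (F.map v₂).right) ≫ (c.ι.app k).right = x.right
          rw [Category.assoc, w₂, hb]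
    have hinj (j : J) (x y : Arrow.mk f ⟶ F.obj j) (hxy : x ≫ c.ι.app j = y ≫ c.ι.app j) :
        ∃ (k : J) (v : j ⟶ k), x ≫ F.map v = y ≫ F.map v := by
      obtain ⟨k₁, v₁, e₁⟩ := IsCardinalPresentable.exists_eq_of_isColimit' (X := A) κ h₁ x.left y.left
        (congrArg CommaMorphism.left hxy)
      obtain ⟨k₂, v₂, e₂⟩ := IsCardinalPresentable.exists_eq_of_isColimit' (X := B) κ h₂ x.right y.right
        (congrArg CommaMorphism.right hxy)
      replace e₁ : x.left ≫ (F.map v₁).left = y.left ≫ (F.map v₁).left := e₁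
      replace e₂ : x.right ≫ (F.map v₂).right = y.right ≫ (F.map v₂).right := e₂
      obtain ⟨k, u₁, u₂, hu⟩ := IsFiltered.span v₁ v₂
      refine ⟨k, v₁ ≫ u₁, ?_⟩
      apply Arrow.hom_ext
      · change x.left ≫ (F.map (v₁ ≫ u₁)).left = y.left ≫ (F.map (v₁ ≫ u₁)).left
        rw [F.map_comp, Arrow.comp_left, reassoc_of% e₁]
      · change x.right ≫ (F.map (v₁ ≫ u₁)).right = y.right ≫ (F.map (v₁ ≫ u₁)).right
        rw [hu, F.map_comp, Arrow.comp_right, reassoc_of% e₂]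
    refine Types.FilteredColimit.isColimitOf' _ _ (fun x => ?_) (fun j x y hxy => ?_)
    · obtain ⟨j, y, hy⟩ := hsurj x
      exact ⟨j, y, hy.symm⟩
    · exact hinj j x y hxy⟩⟩⟩

/-- Identities and morphisms from the initial object, on objects satisfying `P`. -/
noncomputable def generatorFamily (P : ObjectProperty C) : Subtype P ⊕ Subtype P → Arrow C
  | .inl G => Arrow.mk (𝟙 G.1)
  | .inr G => Arrow.mk (initial.to G.1)

/-- Maps out of `𝟙 G` are maps `G ⟶ X.left`, and maps out of `∅ ⟶ G` are maps `G ⟶ X.right`, so both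
components are tested by `P`. -/
lemma isStrongGenerator_generatorFamily {P : ObjectProperty C} (hP : P.IsStrongGenerator) :
    (ObjectProperty.ofObj (generatorFamily P)).IsStrongGenerator := by
  have h₁ (G : C) (hG : P G) : ObjectProperty.ofObj (generatorFamily P) (Arrow.mk (𝟙 G)) :=
    ObjectProperty.ofObj_apply (generatorFamily P) (Sum.inl ⟨G, hG⟩)
  have h₂ (G : C) (hG : P G) :
      ObjectProperty.ofObj (generatorFamily P) (Arrow.mk (initial.to G)) :=
    ObjectProperty.ofObj_apply (generatorFamily P) (Sum.inr ⟨G, hG⟩)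
  have hl (G : C) (X : Arrow C) (a : G ⟶ X.left) : a ≫ X.hom = 𝟙 G ≫ a ≫ X.hom := by simp
  have hr (G : C) (X : Arrow C) (a : G ⟶ X.right) :
      initial.to X.left ≫ X.hom = initial.to G ≫ a := Subsingleton.elim _ _
  rw [ObjectProperty.isStrongGenerator_iff] at hP ⊢
  refine ⟨fun X Y φ ψ h => ?_, fun X Y i _ hi => ?_⟩
  · apply Arrow.hom_ext
    · refine hP.1 _ _ (fun G hG a => ?_)
      exact congrArg CommaMorphism.left (h _ (h₁ G hG) (Arrow.homMk a (a ≫ X.hom) (hl G X a)))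
    · refine hP.1 _ _ (fun G hG a => ?_)
      exact congrArg CommaMorphism.right
        (h _ (h₂ G hG) (Arrow.homMk (initial.to _) a (hr G X a)))
  · have hleft : IsIso i.left := by
      refine hP.2 _ (fun G hG a => ?_)
      obtain ⟨b, hb⟩ := hi _ (h₁ G hG) (Arrow.homMk a (a ≫ Y.hom) (hl G Y a))
      exact ⟨b.left, congrArg CommaMorphism.left hb⟩
    have : Mono i.right := ⟨fun {G} a b hab => by
      have : Arrow.homMk (f := Arrow.mk (initial.to G)) (initial.to _) a (hr G X a) =
          Arrow.homMk (initial.to _) b (hr G X b) := by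
        rw [← cancel_mono i]
        exact Arrow.hom_ext _ _ (initialIsInitial.hom_ext _ _) hab
      exact congrArg CommaMorphism.right this⟩
    have hright : IsIso i.right := by
      refine hP.2 _ (fun G hG a => ?_)
      obtain ⟨b, hb⟩ := hi _ (h₂ G hG) (Arrow.homMk (initial.to _) a (hr G Y a))
      exact ⟨b.right, congrArg CommaMorphism.right hb⟩
    exact Arrow.isIso_of_isIso_left_of_isIso_right i

omit [HasColimits C] in
lemma isCardinalLocallyPresentable [IsCardinalLocallyPresentable C κ] :
    IsCardinalLocallyPresentable (Arrow C) κ := by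
  obtain ⟨P, _, hP₁, hP₂⟩ :=
    (IsCardinalLocallyPresentable.iff_exists_isStrongGenerator C κ).1 inferInstance
  rw [IsCardinalLocallyPresentable.iff_exists_isStrongGenerator]
  refine ⟨_, inferInstance, isStrongGenerator_generatorFamily hP₁, ?_⟩
  have h (G : C) (hG : P G) : IsCardinalPresentable G κ := hP₂ _ hG
  have : IsCardinalPresentable (⊥_ C) κ :=
    have (k : Discrete PEmpty.{1}) : IsCardinalPresentable ((Functor.empty.{0} C).obj k) κ :=
      k.as.elim
    isCardinalPresentable_of_isColimit _ (colimit.isColimit (Functor.empty.{0} C)) κ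
      (hasCardinalLT_of_finite _ _ (Cardinal.IsRegular.aleph0_le Fact.out))
  rintro _ ⟨⟨G, hG⟩ | ⟨G, hG⟩⟩
  · have := h G hG
    exact isCardinalPresentable_mk κ (𝟙 G)
  · have := h G hG
    exact isCardinalPresentable_mk κ (initial.to G)

end CategoryTheory.Arrow

/-! ### Accessibility of the small object argument. -/

namespace CategoryTheory.Functor

/-- A colimit of `κ`-accessible functors is `κ`-accessible. -/
lemma isCardinalAccessible_of_isColimit {K D E : Type*} [Category* K] [Category* D] [Category* E]
    [HasColimitsOfShape K E] {F : K ⥤ D ⥤ E} {c : Cocone F} (hc : IsColimit c)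
    (κ : Cardinal.{w}) [Fact κ.IsRegular] [∀ k, (F.obj k).IsCardinalAccessible κ] :
    c.pt.IsCardinalAccessible κ where
  preservesColimitOfShape J _ _ := by
    have (k : K) := (F.obj k).preservesColimitsOfShape_of_isCardinalAccessible κ J
    -- Colimits commute with colimits: `F.flip` preserves them pointwise, and `colim` is a left
    -- adjoint.
    have : PreservesColimitsOfShape J F.flip := ⟨fun {G} => ⟨fun {d} hd =>
      ⟨evaluationJointlyReflectsColimits _ (fun k => isColimitOfPreserves (F.obj k) hd)⟩⟩⟩
    have : PreservesColimitsOfShape J (colim (J := K) (C := E)) :=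
      colimConstAdj.leftAdjoint_preservesColimits.1
    have e : F.flip ⋙ colim ≅ c.pt :=
      NatIso.ofComponents (fun X =>
        (colimit.isColimit (F.flip.obj X)).coconePointUniqueUpToIso
          (isColimitOfPreserves ((evaluation D E).obj X) hc)) (fun {X Y} f => by
        apply colimit.hom_ext
        intro k
        have h₁ := (colimit.isColimit (F.flip.obj X)).comp_coconePointUniqueUpToIso_hom
          (isColimitOfPreserves ((evaluation D E).obj X) hc) k
        have h₂ := (colimit.isColimit (F.flip.obj Y)).comp_coconePointUniqueUpToIso_hom
          (isColimitOfPreserves ((evaluation D E).obj Y) hc) k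
        dsimp at h₁ h₂ ⊢
        rw [ι_colimMap_assoc, h₂, reassoc_of% h₁]
        exact (c.ι.app k).naturality f)
    exact preservesColimitsOfShape_of_natIso e

end CategoryTheory.Functor

namespace CategoryTheory.SmallObject

variable {C : Type u} [Category.{w} C] [HasColimits C] {ι : Type*} {A B : ι → C}
  (f : ∀ i, A i ⟶ B i)

section

variable {X S : C} (p : X ⟶ S) [HasColimitsOfShape (Discrete (FunctorObjIndex f p)) C]

/-- The cell of `functorObj f p` attached along a commutative square. -/
noncomputable def cell {i : ι} (φ : Arrow.mk (f i) ⟶ Arrow.mk p) : B i ⟶ functorObj f p :=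
  Sigma.ι (functorObjTgtFamily f p) (FunctorObjIndex.mk i φ.left φ.right (Arrow.w φ)) ≫
    ρFunctorObj f p

lemma comp_cell {i : ι} (φ : Arrow.mk (f i) ⟶ Arrow.mk p) :
    f i ≫ cell f p φ = φ.left ≫ ιFunctorObj f p :=
  FunctorObjIndex.comm f p (FunctorObjIndex.mk i φ.left φ.right (Arrow.w φ))

variable {f p} in
lemma functorObj_hom_ext {Z : C} {a b : functorObj f p ⟶ Z}
    (h₁ : ιFunctorObj f p ≫ a = ιFunctorObj f p ≫ b)
    (h₂ : ∀ (i : ι) (φ : Arrow.mk (f i) ⟶ Arrow.mk p), cell f p φ ≫ a = cell f p φ ≫ b) :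
    a = b := by
  refine pushout.hom_ext h₁ (Sigma.hom_ext _ _ (fun x => ?_))
  have := h₂ x.i (Arrow.homMk x.t x.b x.w)
  unfold cell at this
  rw [Category.assoc, Category.assoc] at this
  exact this

lemma exists_functorObj_desc {Z : C} (a : X ⟶ Z)
    (v : ∀ (i : ι) (_ : Arrow.mk (f i) ⟶ Arrow.mk p), B i ⟶ Z)
    (hv : ∀ i φ, f i ≫ v i φ = φ.left ≫ a) :
    ∃ l : functorObj f p ⟶ Z, ιFunctorObj f p ≫ l = a ∧ ∀ i φ, cell f p φ ≫ l = v i φ := by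
  refine ⟨pushout.desc a (Limits.Sigma.desc
    (fun x : FunctorObjIndex f p => v x.i (Arrow.homMk x.t x.b x.w))) ?_,
    pushout.inl_desc _ _ _, fun i φ => ?_⟩
  · refine Sigma.hom_ext _ _ (fun x => ?_)
    rw [Sigma.ι_desc_assoc, Sigma.ι_map_assoc, Sigma.ι_desc]
    exact (hv x.i (Arrow.homMk x.t x.b x.w)).symm
  · unfold cell
    rw [Category.assoc, pushout.inr_desc, Sigma.ι_desc]
    rfl

end

section

variable [∀ {X S : C} (πX : X ⟶ S), HasColimitsOfShape (Discrete (FunctorObjIndex f πX)) C]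

lemma cell_functorMap {X S Y T : C} {p : X ⟶ S} {q : Y ⟶ T} {i : ι}
    (φ : Arrow.mk (f i) ⟶ Arrow.mk p) (τ : Arrow.mk p ⟶ Arrow.mk q) :
    cell f p φ ≫ functorMap f τ = cell f q (φ ≫ τ) := by
  unfold cell functorMap
  rw [Category.assoc, pushout.map, pushout.inr_desc]
  exact ι_functorMapTgt_assoc f τ i φ.left φ.right (Arrow.w φ) _ rfl _ rfl _

/-- One step attaches a cell for each square from some `f i`. As `f i` is presentable in the arrow
category, each square into the colimit comes from a stage, and two representatives agree at a later
stage. -/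
lemma isCardinalAccessible_functor (κ : Cardinal.{w}) [Fact κ.IsRegular]
    [∀ i, IsCardinalPresentable (Arrow.mk (f i)) κ] : (functor f).IsCardinalAccessible κ := by
  have : (functor f ⋙ Arrow.rightFunc).IsCardinalAccessible κ :=
    ⟨fun J _ _ => inferInstanceAs
      (PreservesColimitsOfShape J (Arrow.rightFunc : Arrow C ⥤ C))⟩
  suffices (functor f ⋙ Arrow.leftFunc).IsCardinalAccessible κ from
    Arrow.isCardinalAccessible_of_left_right κ _
  refine ⟨fun J _ _ => ⟨fun {F} => ⟨fun {c} hc => ⟨?_⟩⟩⟩⟩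
  have := isFiltered_of_isCardinalFiltered J κ
  have hl := isColimitOfPreserves Arrow.leftFunc hc
  have hexists (s : Cocone (F ⋙ functor f ⋙ Arrow.leftFunc)) :
      ∃ l : functorObj f c.pt.hom ⟶ s.pt, ∀ j, functorMap f (c.ι.app j) ≫ l = s.ι.app j := by
    let s' : ∀ j, functorObj f (F.obj j).hom ⟶ s.pt := s.ι.app
    have hs' {j k : J} (a : j ⟶ k) : functorMap f (F.map a) ≫ s' k = s' j := s.w a
    let t : Cocone (F ⋙ Arrow.leftFunc) :=
      { pt := s.pt
        ι.app j := ιFunctorObj f (F.obj j).hom ≫ s' j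
        ι.naturality j k a := by
          have h := ιFunctorObj_naturality f (F.map a)
          refine Eq.trans ?_ (Category.comp_id _).symm
          rw [← hs' a]
          exact ((Category.assoc _ _ _).symm.trans (congrArg (· ≫ s' k) h.symm)).trans
            (Category.assoc _ _ _) }
    choose j φ' hφ' using fun (i : ι) (φ : Arrow.mk (f i) ⟶ c.pt) =>
      IsCardinalPresentable.exists_hom_of_isColimit κ hc φ
    -- The value on a cell does not depend on the stage chosen to represent it.
    have hv (i : ι) {k : J} (ψ : Arrow.mk (f i) ⟶ F.obj k) {k' : J}
        (ψ' : Arrow.mk (f i) ⟶ F.obj k') (hψ : ψ ≫ c.ι.app k = ψ' ≫ c.ι.app k') :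
        cell f (F.obj k).hom ψ ≫ s' k = cell f (F.obj k').hom ψ' ≫ s' k' := by
      obtain ⟨m, a, b, hab⟩ := IsCardinalPresentable.exists_eq_of_isColimit κ hc ψ ψ' hψ
      rw [← hs' a, ← hs' b, ← Category.assoc, ← Category.assoc]
      congr 1
      refine (cell_functorMap f ψ (F.map a)).trans (Eq.trans ?_
        (cell_functorMap f ψ' (F.map b)).symm)
      exact congrArg (cell f (F.obj m).hom) hab
    have hd (k : J) : (c.ι.app k).left ≫ hl.desc t = ιFunctorObj f (F.obj k).hom ≫ s' k :=
      hl.fac t k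
    obtain ⟨l, hl₁, hl₂⟩ := exists_functorObj_desc f c.pt.hom (hl.desc t)
      (fun i φ => cell f (F.obj (j i φ)).hom (φ' i φ) ≫ s' (j i φ)) (fun i φ => by
        rw [← Category.assoc]
        refine (congrArg (· ≫ s' (j i φ)) (comp_cell f (F.obj (j i φ)).hom (φ' i φ))).trans ?_
        rw [Category.assoc]
        refine (congrArg ((φ' i φ).left ≫ ·) (hd (j i φ)).symm).trans ?_
        refine (Category.assoc _ _ _).symm.trans ?_
        exact congrArg (fun (ψ : Arrow.mk (f i) ⟶ c.pt) => ψ.left ≫ hl.desc t) (hφ' i φ))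
    refine ⟨l, fun k => functorObj_hom_ext ?_ (fun i φ => ?_)⟩
    · have h := ιFunctorObj_naturality f (c.ι.app k)
      rw [← Category.assoc]
      refine (congrArg (· ≫ l) h).trans ?_
      rw [Category.assoc]
      exact (congrArg ((c.ι.app k).left ≫ ·) hl₁).trans (hd k)
    · rw [← Category.assoc]
      refine (congrArg (· ≫ l) (cell_functorMap f φ (c.ι.app k))).trans ?_
      refine (hl₂ i _).trans (hv i _ _ (hφ' i _))
  have hext {Z : C} {a b : functorObj f c.pt.hom ⟶ Z}
      (hab : ∀ k, functorMap f (c.ι.app k) ≫ a = functorMap f (c.ι.app k) ≫ b) : a = b := by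
    refine functorObj_hom_ext ?_ (fun i φ => ?_)
    · refine hl.hom_ext (fun k => ?_)
      have h (a : functorObj f c.pt.hom ⟶ Z) : (c.ι.app k).left ≫ ιFunctorObj f c.pt.hom ≫ a =
          ιFunctorObj f (F.obj k).hom ≫ functorMap f (c.ι.app k) ≫ a :=
        (ιFunctorObj_naturality_assoc f (c.ι.app k) a).symm
      exact (h a).trans ((congrArg (ιFunctorObj f (F.obj k).hom ≫ ·) (hab k)).trans (h b).symm)
    · obtain ⟨k, ψ, hψ⟩ := IsCardinalPresentable.exists_hom_of_isColimit κ hc φ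
      have h : cell f (F.obj k).hom ψ ≫ functorMap f (c.ι.app k) = cell f c.pt.hom φ :=
        (cell_functorMap f ψ (c.ι.app k)).trans (congrArg (cell f c.pt.hom) hψ)
      have h' (a : functorObj f c.pt.hom ⟶ Z) : cell f c.pt.hom φ ≫ a =
          cell f (F.obj k).hom ψ ≫ functorMap f (c.ι.app k) ≫ a :=
        (congrArg (· ≫ a) h.symm).trans (Category.assoc _ _ _)
      exact (h' a).trans ((congrArg (cell f (F.obj k).hom ψ ≫ ·) (hab k)).trans (h' b).symm)
  choose l hl' using hexists
  exact
    { desc := l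
      fac := hl'
      uniq := fun s m hm => hext (fun k => (hm k).trans (hl' s k).symm) }

end

end CategoryTheory.SmallObject

namespace CategoryTheory

lemma exists_cardinal_forall_isCardinalPresentable (C : Type u) [Category.{w} C]
    [IsLocallyPresentable.{w} C] {ι : Type*} [Small.{w} ι] (X : ι → C) :
    ∃ (κ : Cardinal.{w}) (_ : Fact κ.IsRegular), IsCardinalLocallyPresentable C κ ∧
      ∀ i, IsCardinalPresentable (X i) κ := by
  obtain ⟨κ₀, _, _⟩ := IsLocallyPresentable.exists_cardinal.{w} C
  have hX (i : ι) : IsPresentable.{w} (X i) := inferInstance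
  choose κ' hκ' h' using fun i => (hX i).exists_cardinal
  obtain ⟨κ, hκ, h⟩ := HasCardinalLT.exists_regular_cardinal_forall.{w}
    (Sum.elim (fun (_ : Unit) => κ₀.ord.ToType) (fun i => (κ' i).ord.ToType))
  have : Fact κ.IsRegular := ⟨hκ⟩
  refine ⟨κ, inferInstance, IsCardinalLocallyPresentable.of_le C
    (le_of_lt (by simpa [hasCardinalLT_iff_cardinal_mk_lt] using h (Sum.inl ⟨⟩)) : κ₀ ≤ κ),
    fun i => isCardinalPresentable_of_le _
    (le_of_lt (by simpa [hasCardinalLT_iff_cardinal_mk_lt] using h (Sum.inr i)) : κ' i ≤ κ)⟩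

namespace SmallObject

variable {C : Type u} [Category.{w} C] [HasColimits C] (I : MorphismProperty C)
  (κ : Cardinal.{w}) [Fact κ.IsRegular] [OrderBot κ.ord.ToType]

lemma isCardinalForSmallObjectArgument [IsSmall.{w} I]
    (hI : ∀ {A B : C} (i : A ⟶ B), I i → IsCardinalPresentable A κ) :
    I.IsCardinalForSmallObjectArgument κ where
  preservesColimit {A _ _ _} i hi _ _ := by
    have := hI i hi
    have := preservesColimitsOfShape_of_isCardinalPresentable A κ κ.ord.ToType
    infer_instance

variable [I.IsCardinalForSmallObjectArgument κ]

/-- Transfinite induction: the identity at the bottom, composition with the one-step functor at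
successors, a colimit of accessible functors at limits. -/
lemma isCardinalAccessible_iterationFunctor_obj
    (hI : ∀ {A B : C} (i : A ⟶ B), I i → IsCardinalPresentable (Arrow.mk i) κ)
    (j : κ.ord.ToType) : ((iterationFunctor I κ).obj j).IsCardinalAccessible κ := by
  have := hasColimitsOfShape_discrete I κ
  have := hasIterationOfShape I κ
  have := Cardinal.noMaxOrder (Fact.elim inferInstance : κ.IsRegular).aleph0_le
  have (i : I.toSet) : IsCardinalPresentable (Arrow.mk (I.homFamily i)) κ := hI _ i.2
  have := isCardinalAccessible_functor I.homFamily κ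
  induction j using SuccOrder.limitRecOn with
  | isMin j hj =>
    obtain rfl := hj.eq_bot
    exact Functor.isCardinalAccessible_of_natIso (F := 𝟭 _)
      ((succStruct I κ).iterationFunctorObjBotIso κ.ord.ToType).symm κ
  | succ j _ ih =>
    exact Functor.isCardinalAccessible_of_natIso
      (F := (iterationFunctor I κ).obj j ⋙ functor I.homFamily)
      ((succStruct I κ).iterationFunctorObjSuccIso j (not_isMax j)).symm κ
  | isSuccLimit j hj ih =>
    have : (iterationFunctor I κ).IsWellOrderContinuous :=
      inferInstanceAs ((succStruct I κ).iterationFunctor κ.ord.ToType).IsWellOrderContinuous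
    have (k : Set.Iio j) :
        (((Set.principalSegIio j).monotone.functor ⋙ iterationFunctor I κ).obj k).IsCardinalAccessible
          κ := ih k.1 k.2
    exact Functor.isCardinalAccessible_of_isColimit
      ((iterationFunctor I κ).isColimitOfIsWellOrderContinuous j hj) κ

lemma isCardinalAccessible_iteration
    (hI : ∀ {A B : C} (i : A ⟶ B), I i → IsCardinalPresentable (Arrow.mk i) κ) :
    (iteration I κ).IsCardinalAccessible κ := by
  have := hasIterationOfShape I κ
  have (j : κ.ord.ToType) :
      (((succStruct I κ).iterationFunctor κ.ord.ToType).obj j).IsCardinalAccessible κ :=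
    isCardinalAccessible_iterationFunctor_obj I κ hI j
  exact Functor.isCardinalAccessible_of_isColimit
    ((succStruct I κ).isColimitIterationCocone κ.ord.ToType) κ

/-- The arrow `(iteration I κ).obj f` is isomorphic to the projection of the factorization of
`f` given by the small object argument. -/
noncomputable def iterationObjIso (f : Arrow C) :
    (iteration I κ).obj f ≅ Arrow.mk (πObj I κ f.hom) :=
  Arrow.isoMk (Iso.refl _) (iterationObjRightIso I κ f).symm (by
    change 𝟙 _ ≫ πObj I κ f.hom = _
    rw [Category.id_comp]
    rfl)

end SmallObject

lemma hasSmallObjectArgument {C : Type u} [Category.{w} C] [IsLocallyPresentable.{w} C]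
    (I : MorphismProperty C) [IsSmall.{w} I] : HasSmallObjectArgument.{w} I := by
  obtain ⟨κ, _, _, h⟩ := exists_cardinal_forall_isCardinalPresentable C
    (fun i : I.toSet => i.1.left)
  have : Nonempty κ.ord.ToType := by simpa using Cardinal.IsRegular.ne_zero Fact.out
  let := WellFoundedLT.toOrderBot κ.ord.ToType
  exact ⟨κ, inferInstance, inferInstance,
    SmallObject.isCardinalForSmallObjectArgument I κ (fun i hi => h ⟨Arrow.mk i, hi⟩)⟩

end CategoryTheory

/-! ### Accessible replacement by left fibrations with left fibrant codomain. -/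

namespace CategoryTheory

variable {C : Type u} [Category.{w} C]

/-- The functor sending `X` to the morphism from `X` to the terminal object. -/
noncomputable def toTerminal (C : Type u) [Category.{w} C] [HasTerminal C] : C ⥤ Arrow C where
  obj X := Arrow.mk (terminal.from X)
  map f := Arrow.homMk f (𝟙 _) (by simp)

/-- The functor sending `f : X ⟶ Y` to the composition `X ⟶ Y ⟶ F.obj Y`, for a natural
transformation `η : 𝟭 C ⟶ F`. -/
def arrowPostcomp {F : C ⥤ C} (η : 𝟭 C ⟶ F) : Arrow C ⥤ Arrow C where
  obj f := Arrow.mk (f.hom ≫ η.app f.right)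
  map {f g} φ := Arrow.homMk φ.left (F.map φ.right) (by
    have := η.naturality φ.right
    simp at this
    simp [this])

lemma isCardinalAccessible_toTerminal [HasColimits C] [HasTerminal C] (κ : Cardinal.{w})
    [Fact κ.IsRegular] : (toTerminal C).IsCardinalAccessible κ := by
  have : (toTerminal C ⋙ Arrow.leftFunc).IsCardinalAccessible κ :=
    inferInstanceAs ((𝟭 C).IsCardinalAccessible κ)
  have : (toTerminal C ⋙ Arrow.rightFunc).IsCardinalAccessible κ :=
    inferInstanceAs (((Functor.const C).obj (⊤_ C)).IsCardinalAccessible κ)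
  exact Arrow.isCardinalAccessible_of_left_right κ _

lemma isCardinalAccessible_arrowPostcomp [HasColimits C] {F : C ⥤ C} (η : 𝟭 C ⟶ F)
    (κ : Cardinal.{w}) [Fact κ.IsRegular] [F.IsCardinalAccessible κ] :
    (arrowPostcomp η).IsCardinalAccessible κ := by
  have hl : (Arrow.leftFunc : Arrow C ⥤ C).IsCardinalAccessible κ := ⟨fun _ _ _ => inferInstance⟩
  have hr : (Arrow.rightFunc : Arrow C ⥤ C).IsCardinalAccessible κ := ⟨fun _ _ _ => inferInstance⟩
  have : (arrowPostcomp η ⋙ Arrow.leftFunc).IsCardinalAccessible κ := hl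
  have : (arrowPostcomp η ⋙ Arrow.rightFunc).IsCardinalAccessible κ :=
    inferInstanceAs ((Arrow.rightFunc ⋙ F : Arrow C ⥤ C).IsCardinalAccessible κ)
  exact Arrow.isCardinalAccessible_of_left_right κ _

/-- A small object argument yields an accessible functorial replacement of an arrow `X ⟶ Y` by an
arrow with the right lifting property and with a codomain which is injective. -/
lemma exists_isCardinalAccessible_replacement [HasColimits C] [HasTerminal C]
    (I : MorphismProperty C) [IsSmall.{w} I] (κ : Cardinal.{w}) [Fact κ.IsRegular]
    (hI : ∀ {A B : C} (i : A ⟶ B), I i → IsCardinalPresentable A κ ∧ IsCardinalPresentable B κ) :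
    ∃ T : Arrow C ⥤ Arrow C, T.IsCardinalAccessible κ ∧ ∀ f : Arrow C,
      ∃ (a : f.left ⟶ (T.obj f).left) (b : f.right ⟶ (T.obj f).right),
        f.hom ≫ b = a ≫ (T.obj f).hom ∧ I.rlp.llp a ∧ I.rlp.llp b ∧ I.rlp (T.obj f).hom ∧
          I.rlp (terminal.from (T.obj f).right) := by
  have : Nonempty κ.ord.ToType := by simpa using Cardinal.IsRegular.ne_zero Fact.out
  let := WellFoundedLT.toOrderBot κ.ord.ToType
  have := SmallObject.isCardinalForSmallObjectArgument I κ (fun i hi => (hI i hi).1)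
  have : (SmallObject.iteration I κ).IsCardinalAccessible κ :=
    SmallObject.isCardinalAccessible_iteration I κ (fun i hi => by
      obtain ⟨_, _⟩ := hI i hi
      infer_instance)
  have hl : (Arrow.leftFunc : Arrow C ⥤ C).IsCardinalAccessible κ := ⟨fun _ _ _ => inferInstance⟩
  have := isCardinalAccessible_toTerminal (C := C) κ
  -- `η` is the functorial replacement of the target, from the factorization of `Y ⟶ ⊤_ C`. Then `T`
  -- factors `X ⟶ Y` followed by `η` and keeps the second factor.
  let η : 𝟭 C ⟶ toTerminal C ⋙ SmallObject.iteration I κ ⋙ Arrow.leftFunc :=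
    { app X := ((SmallObject.ιIteration I κ).app (Arrow.mk (terminal.from X))).left
      naturality X Y f := congrArg CommaMorphism.left
        ((SmallObject.ιIteration I κ).naturality ((toTerminal C).map f)) }
  have := isCardinalAccessible_arrowPostcomp η κ
  refine ⟨arrowPostcomp η ⋙ SmallObject.iteration I κ, inferInstance, fun f => ?_⟩
  let g := f.hom ≫ η.app f.right
  refine ⟨((SmallObject.ιIteration I κ).app (Arrow.mk g)).left,
    η.app f.right ≫ ((SmallObject.ιIteration I κ).app (Arrow.mk g)).right,
      ?_, ?_, ?_, ?_, ?_⟩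
  · exact (Category.assoc _ _ _).symm.trans (Arrow.w ((SmallObject.ιIteration I κ).app (Arrow.mk g))).symm
  · exact SmallObject.llp_rlp_ιObj I κ g
  · have h := SmallObject.llp_rlp_ιObj I κ (terminal.from f.right)
    exact I.rlp.llp.comp_mem _ _ h
      (MorphismProperty.of_isIso _ (SmallObject.iterationObjRightIso I κ (Arrow.mk g)).hom)
  · exact (I.rlp.arrow_mk_iso_iff (SmallObject.iterationObjIso I κ (Arrow.mk g))).2
      (SmallObject.rlp_πObj I κ g)
  · have e : SmallObject.obj I κ (terminal.from f.right) ≅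
        ((SmallObject.iteration I κ).obj (Arrow.mk g)).right :=
      SmallObject.iterationObjRightIso I κ (Arrow.mk g)
    have e' : Arrow.mk (SmallObject.πObj I κ (terminal.from f.right)) ≅
        Arrow.mk (terminal.from ((SmallObject.iteration I κ).obj (Arrow.mk g)).right) :=
      Arrow.isoMk e (Iso.refl _) (terminal.hom_ext _ _)
    exact (I.rlp.arrow_mk_iso_iff e').1 (SmallObject.rlp_πObj I κ (terminal.from f.right))

end CategoryTheory
namespace DirectedCylinder.LeftHomotopicalStructure

variable {C : Type u} [Category.{w} C] [HasColimits C] [HasTerminal C] {L : MorphismProperty C}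
  (H : LeftHomotopicalStructure L)

/-- The comparison maps from `f` to its replacement are anodyne, so `f` and `T f` are in `H.W`
together; for a left fibration with left fibrant codomain, `H.W` and `L.rlp` agree. -/
lemma exists_isCardinalAccessible_W_iff (hL : ∀ X : C, L (initial.to X)) (Λ : MorphismProperty C)
    [IsSmall.{w} Λ] (hΛ : H.An = Λ.rlp.llp) (κ : Cardinal.{w}) [Fact κ.IsRegular]
    (hΛκ : ∀ {A B : C} (i : A ⟶ B), Λ i → IsCardinalPresentable A κ ∧ IsCardinalPresentable B κ) :
    ∃ T : Arrow C ⥤ Arrow C, T.IsCardinalAccessible κ ∧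
      ∀ f : Arrow C, H.W f.hom ↔ L.rlp (T.obj f).hom := by
  have hfib : H.leftFibrations = Λ.rlp := by
    rw [leftFibrations, hΛ, rlp_llp_rlp]
  obtain ⟨T, hT, h⟩ := exists_isCardinalAccessible_replacement Λ κ hΛκ
  refine ⟨T, hT, fun f => ?_⟩
  obtain ⟨a, b, fac, ha, hb, hp, hY⟩ := h f
  rw [← hΛ] at ha hb
  rw [← hfib] at hp hY
  have ha' := H.An_le_W _ ha
  have hb' := H.An_le_W _ hb
  have : H.W f.hom ↔ H.W (T.obj f).hom := by
    constructor
    · intro hf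
      refine H.W.of_precomp a _ ha' ?_
      rw [← fac]
      exact H.W.comp_mem _ _ hf hb'
    · intro hf
      refine H.W.of_postcomp _ b hb' ?_
      rw [fac]
      exact H.W.comp_mem _ _ ha' hf
  rw [this]
  exact ⟨H.rlp_of_leftFibrations_of_W hL hY hp, H.rlp_le_W hL _⟩

end DirectedCylinder.LeftHomotopicalStructure

/-! ### The solution set condition for preimages of injectivity classes. -/

namespace CategoryTheory

/-- Formal expressions built from a constant, `κ`-small suprema and unary operations. -/
inductive ClosureTerm (κ : Cardinal.{w}) (S : Type w) : Type w
  | base : ClosureTerm κ S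
  | sup (A : Set κ.ord.ToType) (hA : Cardinal.mk A < κ) (f : A → ClosureTerm κ S) : ClosureTerm κ S
  | step (s : S) (t : ClosureTerm κ S) : ClosureTerm κ S

namespace ClosureTerm

variable {κ : Cardinal.{w}} [Fact κ.IsRegular] {S J : Type w} [Preorder J] [IsCardinalFiltered J κ]
  (j₀ : J) (op : S → J → J)

/-- The evaluation of formal expressions in a `κ`-directed preorder. -/
noncomputable def eval : ClosureTerm κ S → J
  | base => j₀
  | sup _ hA f => IsCardinalFiltered.max (fun a => eval (f a))
      (hasCardinalLT_iff_cardinal_mk_lt _ _ |>.2 hA)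
  | step s t => op s (eval t)

/-- The preorder on formal expressions which is induced by an evaluation. -/
@[reducible]
noncomputable def preorder : Preorder (ClosureTerm κ S) := Preorder.lift (eval j₀ op)

/-- An index set of size below `κ` embeds in `κ.ord.ToType`, so the constructor `sup` covers every
small family while the type of terms depends only on `κ` and `S`, not on `J`. -/
lemma isCardinalFiltered :
    letI := preorder (κ := κ) j₀ op
    IsCardinalFiltered (ClosureTerm κ S) κ := by
  let := preorder (κ := κ) j₀ op
  refine isCardinalFiltered_preorder _ _ (fun K s hK => ?_)
  obtain ⟨e⟩ : Nonempty (K ↪ κ.ord.ToType) := by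
    rw [← Cardinal.le_def, Cardinal.mk_ord_toType]
    exact hK.le
  let e' := Equiv.ofInjective e e.injective
  have hA : Cardinal.mk (Set.range e) < κ := by rwa [← Cardinal.mk_congr e']
  refine ⟨sup (Set.range e) hA (fun a => s (e'.symm a)), fun k => ?_⟩
  have := leOfHom (IsCardinalFiltered.toMax
    (fun a : Set.range e => eval j₀ op (s (e'.symm a)))
    (hasCardinalLT_iff_cardinal_mk_lt _ _ |>.2 hA) (e' k))
  rw [e'.symm_apply_apply] at this
  exact this

end ClosureTerm

section

variable {𝒟 ℰ : Type*} [Category.{w} 𝒟] [Category.{w} ℰ] [HasColimits 𝒟]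
  {ω : Type w} {a b : ω → ℰ} (q : ∀ i, a i ⟶ b i)

/-- An object is injective with respect to a family of morphisms. -/
def IsInjectiveFor (Y : ℰ) : Prop := ∀ (i : ω) (x : a i ⟶ Y), ∃ y : b i ⟶ Y, q i ≫ y = x

variable {q} {κ : Cardinal.{w}} [Fact κ.IsRegular]
  [∀ i, IsCardinalPresentable (a i) κ] [∀ i, IsCardinalPresentable (b i) κ]
  (T : 𝒟 ⥤ ℰ) [T.IsCardinalAccessible κ]

-- An extension exists in the colimit. Presentability of `b i` brings it down to a stage, and
-- presentability of `a i` makes the triangle commute at a later one.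
omit [HasColimits 𝒟] in
lemma IsInjectiveFor.exists_extension {J : Type w} [SmallCategory J] [IsCardinalFiltered J κ]
    {D : J ⥤ 𝒟} {c : Cocone D} (hc : IsColimit c) (hX : IsInjectiveFor q (T.obj c.pt))
    (j : J) (i : ω) (x : a i ⟶ T.obj (D.obj j)) :
    ∃ (j' : J) (f : j ⟶ j') (y : b i ⟶ T.obj (D.obj j')), q i ≫ y = x ≫ T.map (D.map f) := by
  have := T.preservesColimitsOfShape_of_isCardinalAccessible κ J
  have hc' := isColimitOfPreserves T hc
  obtain ⟨y, hy⟩ := hX i (x ≫ T.map (c.ι.app j))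
  obtain ⟨j₁, y₁, hy₁⟩ := IsCardinalPresentable.exists_hom_of_isColimit κ hc' y
  obtain ⟨j', f, g, h⟩ := IsCardinalPresentable.exists_eq_of_isColimit κ hc'
    (i₁ := j) (i₂ := j₁) x (q i ≫ y₁) (by
      rw [Category.assoc, hy₁, hy]
      rfl)
  exact ⟨j', f, y₁ ≫ T.map (D.map g), by
    rw [← Category.assoc]
    exact h.symm⟩

/-- A Löwenheim–Skolem closure: starting at `j₀`, close up under `κ`-small upper bounds and under
passage to a stage solving a given extension problem. Indexing by terms bounds the resulting diagram
independently of `J`. -/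
lemma exists_isInjectiveFor_colimit {J M : Type w} [PartialOrder J] [IsCardinalFiltered J κ]
    [SmallCategory M] (ι : M ⥤ 𝒟) (D : J ⥤ M) {c : Cocone (D ⋙ ι)} (hc : IsColimit c)
    (hX : IsInjectiveFor q (T.obj c.pt)) (j₀ : J) :
    ∃ (_ : Preorder (ClosureTerm κ (Σ (g : M) (i : ω), a i ⟶ T.obj (ι.obj g))))
      (G : ClosureTerm κ (Σ (g : M) (i : ω), a i ⟶ T.obj (ι.obj g)) ⥤ M),
      IsInjectiveFor q (T.obj (colimit (G ⋙ ι))) ∧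
      ∃ (α : ι.obj (D.obj j₀) ⟶ colimit (G ⋙ ι)) (β : colimit (G ⋙ ι) ⟶ c.pt),
        α ≫ β = c.ι.app j₀ := by
  obtain ⟨op, hop⟩ : ∃ op : (Σ (g : M) (i : ω), a i ⟶ T.obj (ι.obj g)) → J → J,
      ∀ j i (x : a i ⟶ T.obj (ι.obj (D.obj j))), ∃ (f : j ⟶ op ⟨D.obj j, i, x⟩ j)
        (y : b i ⟶ T.obj (ι.obj (D.obj (op ⟨D.obj j, i, x⟩ j)))),
        q i ≫ y = x ≫ T.map (ι.map (D.map f)) := by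
    have h (s : Σ (g : M) (i : ω), a i ⟶ T.obj (ι.obj g)) (j : J) : ∃ j' : J,
        ∀ i (x : a i ⟶ T.obj (ι.obj (D.obj j))), s = ⟨D.obj j, i, x⟩ →
        ∃ (f : j ⟶ j') (y : b i ⟶ T.obj (ι.obj (D.obj j'))),
          q i ≫ y = x ≫ T.map (ι.map (D.map f)) := by
      -- Problems are labelled by objects of `M`, not of `J`, to keep the terms independent of `J`;
      -- a label not concerning `D.obj j` leaves `j` fixed.
      by_cases hs : ∃ (i : ω) (x : a i ⟶ T.obj (ι.obj (D.obj j))), s = ⟨D.obj j, i, x⟩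
      · obtain ⟨i, x, rfl⟩ := hs
        obtain ⟨j', f, y, hy⟩ := hX.exists_extension (κ := κ) T hc j i x
        refine ⟨j', fun i' x' h => ?_⟩
        have h' := eq_of_heq (Sigma.mk.inj h).2
        obtain rfl := (Sigma.mk.inj h').1
        obtain rfl := eq_of_heq (Sigma.mk.inj h').2
        exact ⟨f, y, hy⟩
      · exact ⟨j, fun i x h => (hs ⟨i, x, h⟩).elim⟩
    choose op hop using h
    exact ⟨op, fun j i x => hop _ j i x rfl⟩
  let r := ClosureTerm.preorder (κ := κ) j₀ op
  have := ClosureTerm.isCardinalFiltered (κ := κ) j₀ op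
  let ev : ClosureTerm κ (Σ (g : M) (i : ω), a i ⟶ T.obj (ι.obj g)) ⥤ J :=
    Monotone.functor (f := ClosureTerm.eval j₀ op) (fun _ _ h => h)
  refine ⟨r, ev ⋙ D, fun i x => ?_, colimit.ι ((ev ⋙ D) ⋙ ι) ClosureTerm.base,
    colimit.desc _ (c.whisker ev), colimit.ι_desc _ _⟩
  have := T.preservesColimitsOfShape_of_isCardinalAccessible κ
    (ClosureTerm κ (Σ (g : M) (i : ω), a i ⟶ T.obj (ι.obj g)))
  obtain ⟨t, x', hx'⟩ : ∃ t, ∃ x' : a i ⟶ T.obj (ι.obj (D.obj (ev.obj t))),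
      x' ≫ T.map (colimit.ι ((ev ⋙ D) ⋙ ι) t) = x :=
    IsCardinalPresentable.exists_hom_of_isColimit κ
      (isColimitOfPreserves T (colimit.isColimit ((ev ⋙ D) ⋙ ι))) x
  obtain ⟨f, y, hy⟩ := hop _ i x'
  let t' : ClosureTerm κ (Σ (g : M) (i : ω), a i ⟶ T.obj (ι.obj g)) :=
    ClosureTerm.step ⟨D.obj (ev.obj t), i, x'⟩ t
  let f' : t ⟶ t' := homOfLE (leOfHom f)
  refine ⟨y ≫ T.map (colimit.ι ((ev ⋙ D) ⋙ ι) t'), ?_⟩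
  have hf : ι.map (D.map f) ≫ colimit.ι ((ev ⋙ D) ⋙ ι) t' = colimit.ι ((ev ⋙ D) ⋙ ι) t :=
    colimit.w ((ev ⋙ D) ⋙ ι) f'
  rw [← Category.assoc, hy, Category.assoc, ← hx', ← hf]
  exact congrArg (x' ≫ ·) (T.map_comp _ _).symm

variable (q) in
/-- The solution set condition for the objects which become injective after the application
of an accessible functor. -/
lemma exists_solutionSet_isInjectiveFor (κ : Cardinal.{w}) [Fact κ.IsRegular]
    [HasCardinalFilteredGenerator 𝒟 κ]
    [∀ i, IsCardinalPresentable (a i) κ] [∀ i, IsCardinalPresentable (b i) κ]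
    (T : 𝒟 ⥤ ℰ) [T.IsCardinalAccessible κ] :
    ∃ (N : Type w) (Z : N → 𝒟), (∀ n, IsInjectiveFor q (T.obj (Z n))) ∧
      ∀ (K X : 𝒟) [IsCardinalPresentable K κ], IsInjectiveFor q (T.obj X) → ∀ φ : K ⟶ X,
        ∃ (n : N) (α : K ⟶ Z n) (β : Z n ⟶ X), α ≫ β = φ := by
  obtain ⟨P, _, hP⟩ := HasCardinalFilteredGenerator.exists_small_generator 𝒟 κ
  have : EssentiallySmall.{w} P.FullSubcategory := essentiallySmall_of_small_of_locallySmall _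
  let M := SmallModel.{w} P.FullSubcategory
  let e : P.FullSubcategory ≌ M := equivSmallModel.{w} P.FullSubcategory
  let ι : M ⥤ 𝒟 := e.inverse ⋙ P.ι
  let S := ClosureTerm κ (Σ (g : M) (i : ω), a i ⟶ T.obj (ι.obj g))
  -- `S` and `M` are fixed and small, so all diagrams of this shape form a small set that serves
  -- every `X` at once.
  let N := { p : Σ (r : Preorder S), S ⥤ M //
    letI := p.1
    IsInjectiveFor q (T.obj (colimit (p.2 ⋙ ι))) }
  refine ⟨N, fun n => letI := n.1.1; colimit (n.1.2 ⋙ ι), fun n => n.2, fun K X _ hX φ => ?_⟩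
  obtain ⟨J', _, _, ⟨p⟩⟩ := hP.exists_colimitsOfShape X
  -- The closure argument works in a poset, so the filtered index category is replaced by a directed
  -- poset final in it.
  obtain ⟨J, _, _, F, _⟩ := IsCardinalFiltered.exists_cardinal_directed J' κ
  let D₀ : J' ⥤ P.FullSubcategory := P.lift p.diag p.prop_diag_obj
  let D : J ⥤ M := F ⋙ D₀ ⋙ e.functor
  let iso : D ⋙ ι ≅ F ⋙ p.diag :=
    Functor.isoWhiskerLeft (F ⋙ D₀) (Functor.isoWhiskerRight e.unitIso.symm P.ι)
  let c : Cocone (F ⋙ p.diag) := p.cocone.whisker F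
  have hc : IsColimit c := (Functor.Final.isColimitWhiskerEquiv F _).symm p.isColimit
  have hc' : IsColimit ((Cocone.precompose iso.hom).obj c) :=
    (IsColimit.precomposeHomEquiv iso c).symm hc
  obtain ⟨j₀, φ₀, hφ₀⟩ := IsCardinalPresentable.exists_hom_of_isColimit κ hc' φ
  obtain ⟨r, G, hG, α, β, hαβ⟩ :=
    exists_isInjectiveFor_colimit (κ := κ) T ι D hc' hX j₀
  refine ⟨⟨⟨r, G⟩, hG⟩, φ₀ ≫ α, β, ?_⟩
  rw [Category.assoc, hαβ, hφ₀]

end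

end CategoryTheory

/-! ### A small set of generating trivial cofibrations. -/

namespace CategoryTheory

section

variable {C : Type u} [Category.{w} C]

/-- The square from `s` to the identity of its target: the injective arrows with respect to
these squares are the arrows with the right lifting property with respect to `s`. -/
def Arrow.toIdTarget {A B : C} (s : A ⟶ B) : Arrow.mk s ⟶ Arrow.mk (𝟙 B) :=
  Arrow.homMk s (𝟙 B) (by simp)

lemma isInjectiveFor_toIdTarget_iff {ω : Type w} {A B : ω → C} (s : ∀ i, A i ⟶ B i)
    (f : Arrow C) :
    IsInjectiveFor (fun i => Arrow.toIdTarget (s i)) f ↔ (ofHoms s).rlp f.hom := by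
  constructor
  · rintro h _ _ _ ⟨i⟩
    refine ⟨fun {a b} sq => ?_⟩
    obtain ⟨y, hy⟩ := h i (Arrow.homMk a b sq.w)
    have h₁ : s i ≫ y.left = a := congrArg CommaMorphism.left hy
    have h₂ : 𝟙 _ ≫ y.right = b := congrArg CommaMorphism.right hy
    have h₃ : y.left ≫ f.hom = 𝟙 _ ≫ y.right := Arrow.w y
    exact ⟨⟨{ l := y.left, fac_left := h₁, fac_right := h₃.trans h₂ }⟩⟩
  · intro h i x
    have := h _ ⟨i⟩
    have sq : CommSq x.left (s i) f.hom x.right := ⟨Arrow.w x⟩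
    refine ⟨Arrow.homMk sq.lift x.right ?_, ?_⟩
    · exact sq.fac_right.trans (Category.id_comp _).symm
    · ext
      · exact sq.fac_left
      · exact Category.id_comp _

/-- A consequence of the solution set condition, due to Jeff Smith: there is a set `J` of
trivial cofibrations such that the morphisms in `W` with the right lifting property with respect
to `J` are trivial fibrations. -/
lemma exists_isSmall_rlp_inf_le [HasPushouts C] {L R W : MorphismProperty C}
    [IsWeakFactorizationSystem L R] [W.HasTwoOutOfThreeProperty] (hRW : R ≤ W)
    {ω : Type w} {A B : ω → C} (s : ∀ i, A i ⟶ B i) (hs : (ofHoms s).rlp = R)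
    {N : Type w} (Z : N → Arrow C) (hZ : ∀ n, W (Z n).hom)
    (hsol : ∀ (i : ω) (f : Arrow C), W f.hom → ∀ φ : Arrow.mk (s i) ⟶ f,
      ∃ (n : N) (α : Arrow.mk (s i) ⟶ Z n) (β : Z n ⟶ f), α ≫ β = φ) :
    ∃ J : MorphismProperty C, IsSmall.{w} J ∧ J ≤ L ⊓ W ∧ J.rlp ⊓ W ≤ R := by
  have hsL (i : ω) : L (s i) := by
    rw [← llp_eq_of_wfs L R, ← hs]
    exact le_llp_rlp _ _ ⟨i⟩
  have : L.IsStableUnderCobaseChange := by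
    rw [← llp_eq_of_wfs L R]
    infer_instance
  have : L.IsMultiplicative := by
    rw [← llp_eq_of_wfs L R]
    infer_instance
  let g {i : ω} {n : N} (α : Arrow.mk (s i) ⟶ Z n) : pushout (s i) α.left ⟶ (Z n).right :=
    pushout.desc α.right (Z n).hom (Arrow.w α).symm
  let h {i : ω} {n : N} (α : Arrow.mk (s i) ⟶ Z n) := factorizationData L R (g α)
  -- For each square from `s i` to `Z n`, the map from the pushout to the target of `Z n` is
  -- factored, so that `Z n` becomes a map of `L` followed by one of `R`. The first factor is in `W`
  -- by two out of three.
  let J : MorphismProperty C := ofHoms (fun x : Σ (i : ω) (n : N), Arrow.mk (s i) ⟶ Z n =>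
    pushout.inr (s x.1) x.2.2.left ≫ (h x.2.2).i)
  have hJ {i : ω} {n : N} (α : Arrow.mk (s i) ⟶ Z n) :
      J (pushout.inr (s i) α.left ≫ (h α).i) :=
    ofHoms_iff _ _ |>.2 ⟨⟨i, n, α⟩, rfl⟩
  refine ⟨J, inferInstance, ?_, ?_⟩
  · rintro _ _ _ ⟨i, n, α⟩
    refine ⟨L.comp_mem _ _ (L.pushout_inr _ _ (hsL i)) (h α).hi, ?_⟩
    refine W.of_postcomp _ _ (hRW _ (h α).hp) ?_
    rw [Category.assoc, (h α).fac, pushout.inr_desc]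
    exact hZ n
  · rintro X Y p ⟨hpJ, hpW⟩
    rw [← hs]
    rintro _ _ _ ⟨i⟩
    refine ⟨fun {a b} sq => ?_⟩
    -- The square passes through some `Z n`; a lift against the corresponding member of `J`,
    -- restricted along the target of `s i`, solves the original problem.
    obtain ⟨n, α, β, hαβ⟩ := hsol i (Arrow.mk p) hpW (Arrow.homMk a b sq.w)
    have h₁ : α.left ≫ β.left = a := congrArg CommaMorphism.left hαβ
    have h₂ : α.right ≫ β.right = b := congrArg CommaMorphism.right hαβ
    have hβ : β.left ≫ p = (Z n).hom ≫ β.right := Arrow.w β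
    have := hpJ _ (hJ α)
    have sq' : CommSq β.left (pushout.inr (s i) α.left ≫ (h α).i) p ((h α).p ≫ β.right) := ⟨by
      rw [hβ, Category.assoc, reassoc_of% (h α).fac, pushout.inr_desc_assoc]⟩
    refine ⟨⟨{ l := pushout.inl (s i) α.left ≫ (h α).i ≫ sq'.lift
               fac_left := ?_
               fac_right := ?_ }⟩⟩
    · have := sq'.fac_left
      rw [Category.assoc] at this
      rw [pushout.condition_assoc, this, h₁]
    · rw [Category.assoc, Category.assoc, sq'.fac_right, reassoc_of% (h α).fac,
        pushout.inl_desc_assoc, h₂]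

end

end CategoryTheory

namespace DirectedCylinder.LeftHomotopicalStructure

variable {C : Type u} [Category.{w} C] [IsLocallyPresentable.{w} C] {L R : MorphismProperty C}

lemma exists_generators_of_trivialCofibrations (hLR : IsCofibrantlyGeneratedWFS L R)
    (hL : ∀ X : C, L (initial.to X)) (H : LeftHomotopicalStructure L) :
    ∃ J : MorphismProperty C, IsSmall.{w} J ∧ J ≤ L ⊓ H.W ∧ J.rlp ⊓ H.W ≤ R := by
  obtain ⟨_, S, hS, hSR⟩ := hLR
  obtain ⟨Λ, _, hΛL, hΛ⟩ := H.isLeftAnodyneClass.exists_generators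
  obtain ⟨ω, A, B, s, rfl⟩ := (isSmall_iff_eq_ofHoms.{w} S).1 hS
  obtain ⟨κ, _, _, hκ⟩ := exists_cardinal_forall_isCardinalPresentable C
    (Sum.elim (Sum.elim A B) (Sum.elim (fun i : Λ.toSet => i.1.left) (fun i : Λ.toSet => i.1.right)))
  obtain ⟨T, _, hT⟩ := H.exists_isCardinalAccessible_W_iff hL Λ hΛ κ (fun i hi =>
    ⟨hκ (Sum.inr (Sum.inl ⟨Arrow.mk i, hi⟩)), hκ (Sum.inr (Sum.inr ⟨Arrow.mk i, hi⟩))⟩)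
  have (i : ω) : IsCardinalPresentable (A i) κ := hκ (Sum.inl (Sum.inl i))
  have (i : ω) : IsCardinalPresentable (B i) κ := hκ (Sum.inl (Sum.inr i))
  have := Arrow.isCardinalLocallyPresentable (C := C) κ
  obtain ⟨N, Z, hZ, hsol⟩ := exists_solutionSet_isInjectiveFor
    (fun i => Arrow.toIdTarget (s i)) κ T
  have hW (f : Arrow C) : H.W f.hom ↔
      IsInjectiveFor (fun i => Arrow.toIdTarget (s i)) (T.obj f) := by
    rw [isInjectiveFor_toIdTarget_iff, hSR, hT, rlp_eq_of_wfs L R]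
  refine exists_isSmall_rlp_inf_le ?_ s hSR Z (fun n => (hW _).2 (hZ n))
    (fun i f hf φ => hsol _ _ ((hW f).1 hf) φ)
  rw [← rlp_eq_of_wfs L R]
  exact H.rlp_le_W hL

end DirectedCylinder.LeftHomotopicalStructure

/-! ### The model structure: existence, uniqueness and fibrations. -/

namespace HomotopicalAlgebra.ModelCategory

variable {C : Type u} [Category.{w} C]

/-- A model structure is determined by its cofibrations and its weak equivalences. -/
lemma ext_of_cofibrations_weakEquivalences {M N : ModelCategory C}
    (h₁ : @cofibrations C _ M.categoryWithCofibrations =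
      @cofibrations C _ N.categoryWithCofibrations)
    (h₂ : @weakEquivalences C _ M.categoryWithWeakEquivalences =
      @weakEquivalences C _ N.categoryWithWeakEquivalences) : M = N := by
  have h₃ : @fibrations C _ M.categoryWithFibrations =
      @fibrations C _ N.categoryWithFibrations := by
    have h (M : ModelCategory C) : fibrations C = (cofibrations C ⊓ weakEquivalences C).rlp :=
      (rlp_eq_of_wfs (trivialCofibrations C) (fibrations C)).symm
    rw [h M, h N, h₁, h₂]
  obtain ⟨⟨_⟩, ⟨_⟩, ⟨_⟩⟩ := M
  obtain ⟨⟨_⟩, ⟨_⟩, ⟨_⟩⟩ := N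
  obtain rfl : _ = _ := h₁
  obtain rfl : _ = _ := h₂
  obtain rfl : _ = _ := h₃
  rfl

end HomotopicalAlgebra.ModelCategory

namespace DirectedCylinder.LeftHomotopicalStructure

variable {C : Type u} [Category.{w} C] [IsLocallyPresentable.{w} C] {L R : MorphismProperty C}

lemma hasFactorization_An (H : LeftHomotopicalStructure L) :
    HasFactorization H.An H.leftFibrations := by
  obtain ⟨Λ, _, _, hΛ⟩ := H.isLeftAnodyneClass.exists_generators
  have := hasSmallObjectArgument Λ
  rw [leftFibrations, hΛ, rlp_llp_rlp]
  infer_instance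

/-- By `llp_of_W`, left fibrations with left fibrant codomain are in `J.rlp`, so `W_of_llp` puts
`J.rlp.llp` inside `H.W`. Conversely, factor `f` in `L ⊓ H.W` through `J`: the right factor is in
`H.W`, hence in `R`, and `f` is a retract of the left factor. -/
lemma llp_rlp_eq (hLR : IsCofibrantlyGeneratedWFS L R) (hL : ∀ X : C, L (initial.to X))
    (H : LeftHomotopicalStructure L) {J : MorphismProperty C} [IsSmall.{w} J]
    (hJ : J ≤ L ⊓ H.W) (hJR : J.rlp ⊓ H.W ≤ R) : J.rlp.llp = L ⊓ H.W := by
  have := hLR.1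
  have := H.hasFactorization_An
  have hle : J.rlp.llp ≤ L ⊓ H.W := by
    intro X Y f hf
    constructor
    · rw [← llp_eq_of_wfs L R]
      refine antitone_llp ?_ _ hf
      rw [← rlp_eq_of_wfs L R]
      exact antitone_rlp (hJ.trans inf_le_left)
    · refine H.W_of_llp (antitone_llp ?_ _ hf)
      rw [← le_llp_iff_le_rlp]
      intro _ _ j hj
      exact H.llp_of_W hL (hJ _ hj).1 (hJ _ hj).2
  refine le_antisymm hle ?_
  rintro X Y f ⟨hfL, hfW⟩
  have := hasSmallObjectArgument J
  let h := factorizationData J.rlp.llp J.rlp f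
  have hp : R h.p := hJR _ ⟨h.hp, H.W.of_precomp h.i _ (hle _ h.hi).2 (by rwa [h.fac])⟩
  have : HasLiftingProperty f h.p := hasLiftingProperty_of_wfs _ _ hfL hp
  exact of_retract (RetractArrow.ofLeftLiftingProperty h.fac) h.hi

lemma exists_modelCategory (hLR : IsCofibrantlyGeneratedWFS L R)
    (hL : ∀ X : C, L (initial.to X)) (H : LeftHomotopicalStructure L) :
    ∃ M : ModelCategory C, H.IsDescriptionOf M := by
  obtain ⟨J, _, hJ, hJR⟩ := H.exists_generators_of_trivialCofibrations hLR hL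
  have hJ' := H.llp_rlp_eq hLR hL hJ hJR
  have := hLR.1
  have := hasSmallObjectArgument J
  have hR : J.rlp ⊓ H.W = R := by
    refine le_antisymm hJR ?_
    rw [← rlp_eq_of_wfs L R]
    exact le_inf (antitone_rlp (hJ.trans inf_le_left)) (H.rlp_le_W hL)
  let : CategoryWithFibrations C := ⟨J.rlp⟩
  let : CategoryWithCofibrations C := ⟨L⟩
  let : CategoryWithWeakEquivalences C := ⟨H.W⟩
  have h₁ : trivialFibrations C = R := hR
  have h₂ : trivialCofibrations C = J.rlp.llp := hJ'.symm
  have : IsWeakFactorizationSystem (cofibrations C) (trivialFibrations C) := by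
    rw [h₁]
    exact hLR.1
  have : IsWeakFactorizationSystem (trivialCofibrations C) (fibrations C) := by
    rw [h₂]
    exact { rlp := rlp_llp_rlp _
            llp := rfl
            hasFactorization := inferInstanceAs (HasFactorization J.rlp.llp J.rlp) }
  have : (weakEquivalences C).HasTwoOutOfThreeProperty :=
    inferInstanceAs H.W.HasTwoOutOfThreeProperty
  exact ⟨ModelCategory.mk' C, rfl, fun _ => Iff.rfl⟩

section

variable {H : LeftHomotopicalStructure L} {M : ModelCategory C} (hM : H.IsDescriptionOf M)

include hM

lemma IsDescriptionOf.weakEquivalences_eq : weakEquivalences C = H.W := by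
  ext A B f
  exact hM.2 f

lemma IsDescriptionOf.trivialCofibrations_eq : trivialCofibrations C = L ⊓ H.W := by
  rw [trivialCofibrations, hM.1, hM.weakEquivalences_eq]

lemma IsDescriptionOf.leftFibrations_of_fibration {X Y : C} (f : X ⟶ Y) [Fibration f] :
    H.leftFibrations f := by
  intro A B i hi
  refine hasLiftingProperty_of_wfs (W₁ := trivialCofibrations C) (W₂ := fibrations C) i f ?_
    (mem_fibrations f)
  rw [hM.trivialCofibrations_eq]
  exact ⟨H.isLeftAnodyneClass.le _ hi, H.An_le_W _ hi⟩

/-- This is `llp_of_W` read from the side of `f`; only the codomain has to be left fibrant. Applied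
over the terminal object, it also identifies the fibrant objects. -/
lemma IsDescriptionOf.fibration_of_leftFibrations (hL : ∀ X : C, L (initial.to X)) {X Y : C}
    (f : X ⟶ Y) (hY : H.IsLeftFibrant Y) (hf : H.leftFibrations f) : Fibration f := by
  have := H.hasFactorization_An
  rw [fibration_iff, ← rlp_eq_of_wfs (trivialCofibrations C) (fibrations C),
    hM.trivialCofibrations_eq]
  rintro A B i ⟨hi, hiW⟩
  exact H.llp_of_W hL hi hiW f ⟨hf, hY⟩

lemma IsDescriptionOf.fibration_iff_leftFibrations (hL : ∀ X : C, L (initial.to X)) {X Y : C}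
    (f : X ⟶ Y) (hY : H.IsLeftFibrant Y) : Fibration f ↔ H.leftFibrations f :=
  ⟨fun _ => hM.leftFibrations_of_fibration f, hM.fibration_of_leftFibrations hL f hY⟩

end

end DirectedCylinder.LeftHomotopicalStructure

theorem mainTheorem2 {C : Type u} [Category.{w} C] [IsLocallyPresentable.{w} C]
    (L R : MorphismProperty C)
    (hLR : DirectedCylinder.IsCofibrantlyGeneratedWFS L R)
    (hL : ∀ X : C, L (initial.to X)) (H : DirectedCylinder.LeftHomotopicalStructure L) :
    (∃! M : ModelCategory C, H.IsDescriptionOf M) ∧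
    ∀ M : ModelCategory C, H.IsDescriptionOf M →
      (∀ X : C, IsFibrant X ↔ H.IsLeftFibrant X) ∧
      (∀ {X Y : C} (f : X ⟶ Y), H.IsLeftFibrant X → H.IsLeftFibrant Y →
        (Fibration f ↔ H.leftFibrations f)) := by
  refine ⟨?_, fun M hM => ⟨fun X => ?_, fun f _ hY => hM.fibration_iff_leftFibrations hL f hY⟩⟩
  · obtain ⟨M, hM⟩ := H.exists_modelCategory hLR hL
    refine ⟨M, hM, fun N hN => ModelCategory.ext_of_cofibrations_weakEquivalences ?_ ?_⟩
    · exact hN.1.trans hM.1.symm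
    · exact hN.weakEquivalences_eq.trans hM.weakEquivalences_eq.symm
  · exact hM.fibration_iff_leftFibrations hL (terminal.from X) H.isLeftFibrant_terminal
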